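/- **Setting.** Consider first-order linear-time temporal logic (over $\mathbb N$) with predicate symbols of fixed arities and individual constants, without equality and without function symbols of positive arity, with temporal operators $\bigcirc$ (next), $\Box$ (always), $\Diamond$ (sometime), $\mathrm U$, $\mathrm W$. It is interpreted over *expanding domains*: a structure is a sequence $\mathfrak M_n=\langle D_n,I_n\rangle$, $n\in\mathbb N$, of first-order structures with $D_n\neq\emptyset$ and $D_n\subseteq D_m$ for $n<m$, in which constants are rigid and predicates are flexible; truth at moment $n$ is defined for assignments into $D_n$, and quantifiers at moment $n$ range over $D_n$. The symbols $\models$, "valid" and "satisfiable" applied to first-order formulae have their classical meaning. A *monodic temporal problem* (in DSNF) is a quadruple $\mathsf P=\langle\mathcal U,\mathcal I,\mathcal S,\mathcal E\rangle$ of finite sets: $\mathcal U,\mathcal I$ of closed first-order formulae; $\mathcal S$ of step clauses $l\Rightarrow\bigcirc m$ ($l,m$ propositional literals; *ground*) and $L(x)\Rightarrow\bigcirc M(x)$ ($L,M$ unary literals; *non-ground*), no two different ones having the same left-hand side; $\mathcal E$ of eventualities $\Diamond l$ (ground) and $\Diamond L(x)$ (non-ground). It is (un)satisfiable over expanding domains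 if the formula $\mathcal I\wedge\Box\,\mathcal U\wedge\Box\forall x\,\mathcal S\wedge\Box\forall x\,\mathcal E$ is. Its *constant flooded form* $\mathsf P^c$ is $\mathsf P$ extended by the eventualities $\Diamond L(c)$ for all $\Diamond L(x)\in\mathcal E$ and all constants $c$ occurring in $\mathsf P$, where, to stay in DSNF, $L(c)$ is renamed by a new proposition $l_{L,c}$: one adds $\Diamond l_{L,c}$ to $\mathcal E$ and $l_{L,c}\Rightarrow L(c)$ to $\mathcal U$. **Clauses.** For a finite set of non-ground step clauses $P_i(x)\Rightarrow\bigcirc M_i(x)$, $1\le i\le k$ ($k\ge0$), of $\mathcal S$ and a constant $c$ of $\mathsf P$, the *e-derived step clauses* are $\exists x\bigwedge_i P_i(x)\Rightarrow\bigcirc\exists x\bigwedge_i M_i(x)$ and $P_i(c)\Rightarrow\bigcirc M_i(c)$ (there are no universal derived clauses $\forall x\bigvee_i P_i(x)\Rightarrow\bigcirc\forall x\bigvee_i M_i(x)$). A *merged* clause is $\mathcal A\Rightarrow\bigcirc\mathcal B$ with $\mathcal A=\bigwedge_i\Phi_i$, $\mathcal B=\bigwedge_i\Psi_i$ for finitely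 many clauses $\Phi_i\Rightarrow\bigcirc\Psi_i$, each e-derived or an original ground step clause. A *full merged* clause is $\forall x(\mathcal A\wedge A(x)\Rightarrow\bigcirc(\mathcal B\wedge B(x)))$ with $\mathcal A\Rightarrow\bigcirc\mathcal B$ merged and $A(x)=\bigwedge_i P_i(x)$, $B(x)=\bigwedge_i M_i(x)$ for finitely many non-ground clauses $P_i(x)\Rightarrow\bigcirc M_i(x)$ of $\mathcal S$. Empty conjunctions are $\mathbf{true}$. **Rules**, with respect to the current universal part $\mathcal U$: 1. *Step resolution*: from a merged clause $\mathcal A\Rightarrow\bigcirc\mathcal B$ with $\mathcal U\cup\{\mathcal B\}$ unsatisfiable, infer $\neg\mathcal A$. 2. *Eventuality resolution*: from $\Diamond L(x)\in\mathcal E$ and full merged clauses $\forall x(\mathcal A_i\wedge A_i(x)\Rightarrow\bigcirc(\mathcal B_i\wedge B_i(x)))$, $1\le i\le n$, $n\ge1$, such that for all $i$ the formulae $\forall x(\mathcal U\wedge\mathcal B_i\wedge B_i(x)\Rightarrow\neg L(x))$ and $\forall x(\mathcal U\wedge\mathcal B_i\wedge B_i(x)\Rightarrow\bigvee_j(\mathcal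 A_j\wedge A_j(x)))$ are valid, infer $\forall x\bigwedge_i(\neg\mathcal A_i\vee\neg A_i(x))$. 3. *Ground eventuality resolution*: from $\Diamond l\in\mathcal E$ and merged clauses $\mathcal A_i\Rightarrow\bigcirc\mathcal B_i$, $1\le i\le n$, $n\ge 1$, with $\mathcal U\cup\{\mathcal B_i\}\models\neg l$ and $\mathcal U\cup\{\mathcal B_i\}\models\bigvee_j\mathcal A_j$ for all $i$, infer $\bigwedge_i\neg\mathcal A_i$. 4. *Termination rules*: derive $\bot$ and terminate successfully if $\mathcal U\cup\mathcal I$ is unsatisfiable, or $\mathcal U\models\forall x\neg L(x)$ for some $\Diamond L(x)\in\mathcal E$, or $\mathcal U\models\neg l$ for some $\Diamond l\in\mathcal E$. A *successfully terminating derivation* from $\mathsf P$ is a finite sequence $\mathcal U=\mathcal U_0\subseteq\dots\subseteq\mathcal U_n$ in which each $\mathcal U_{i+1}$ is $\mathcal U_i$ together with the conclusion of one of rules 1–3 with respect to $\mathcal U_i$, and a termination rule applies with respect to $\mathcal U_n$; $\mathcal I$, $\mathcal S$, $\mathcal E$ do not change. **Theorem** (Correctness and Completeness of Temporal Resolution for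 the Expanding Domain Case). Let $\mathsf P$ be a monodic temporal problem. *Correctness.* The rules preserve satisfiability over expanding domains: if $\mathsf P$ is satisfiable over expanding domains and $\varphi$ is the conclusion of one of rules 1–3, then $\langle\mathcal U\cup\{\varphi\},\mathcal I,\mathcal S,\mathcal E\rangle$ is satisfiable over expanding domains; if a termination rule applies to $\mathsf P$, then $\mathsf P$ is unsatisfiable over expanding domains. Consequently, if there is a successfully terminating derivation from $\mathsf P$, then $\mathsf P$ is unsatisfiable over expanding domains. *Completeness.* If $\mathsf P$ is unsatisfiable over expanding domains, then there exists a successfully terminating derivation from $\mathsf P^c$. -/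

import Mathlib

universe w

namespace FOTL

open FirstOrder FirstOrder.Language

/-! ### First-order ingredients

A first-order formula with at most the variable `x` free is an `L.BoundedFormula Empty 1`, the
variable `x` being the term `&0`; a closed formula is an `L.Sentence`. -/

section Syntactic

variable {L : FirstOrder.Language.{0, 0}}

/-- The formula does not contain the equality symbol. -/
def EqFree {α : Type} : ∀ {n : ℕ}, L.BoundedFormula α n → Prop
  | _, .falsum => True
  | _, .equal _ _ => False
  | _, .rel _ _ => True
  | _, .imp φ ψ => EqFree φ ∧ EqFree ψ
  | _, .all φ => EqFree φ

/-- The constants that occur in a term. -/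
def termConsts {α : Type} : L.Term α → Set L.Constants
  | .var _ => ∅
  | @Term.func _ _ 0 c _ => {c}
  | @Term.func _ _ (_ + 1) _ ts => ⋃ i, termConsts (ts i)

/-- The constants that occur in a formula. -/
def formulaConsts {α : Type} : ∀ {n : ℕ}, L.BoundedFormula α n → Set L.Constants
  | _, .falsum => ∅
  | _, .equal t₁ t₂ => termConsts t₁ ∪ termConsts t₂
  | _, .rel _ ts => ⋃ i, termConsts (ts i)
  | _, .imp φ ψ => formulaConsts φ ∪ formulaConsts ψ
  | _, .all φ => formulaConsts φ

/-- A closed formula, seen as a formula in which the variable `x` may (but does not) occur. -/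
def weaken (φ : L.Sentence) : L.BoundedFormula Empty 1 :=
  BoundedFormula.liftAt 1 0 φ

end Syntactic

/-! ### Temporal formulas and expanding domains -/

/-- First-order temporal formulas whose free variables are indexed by `Fin n`. The remaining
Boolean connectives and `∃` are definable in the usual way. -/
inductive TFormula (L : FirstOrder.Language.{0, 0}) : ℕ → Type
  | ofFO {n : ℕ} (φ : L.BoundedFormula Empty n) : TFormula L n
  | imp {n : ℕ} (φ ψ : TFormula L n) : TFormula L n
  | all {n : ℕ} (φ : TFormula L (n + 1)) : TFormula L n
  | next {n : ℕ} (φ : TFormula L n) : TFormula L n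
  | always {n : ℕ} (φ : TFormula L n) : TFormula L n
  | sometime {n : ℕ} (φ : TFormula L n) : TFormula L n
  | untl {n : ℕ} (φ ψ : TFormula L n) : TFormula L n
  | wuntl {n : ℕ} (φ ψ : TFormula L n) : TFormula L n

/-- A first-order temporal structure with expanding domains `D₀ ⊆ D₁ ⊆ ⋯`: predicates are
flexible, constants are rigid. -/
structure TemporalStructure (L : FirstOrder.Language.{0, 0}) where
  Carrier : Type w
  dom : ℕ → Set Carrier
  dom_nonempty : ∀ n, Nonempty (dom n)
  dom_mono : Monotone dom
  str : ∀ n, L.Structure (dom n)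
  rigid : ∀ (c : L.Constants) (m n : ℕ),
    (((str m).funMap c default : dom m) : Carrier) = ((str n).funMap c default : dom n)

namespace TemporalStructure

variable {L : FirstOrder.Language.{0, 0}} (M : TemporalStructure.{w} L)

instance (n : ℕ) : L.Structure (M.dom n) := M.str n

/-- The inclusion of an earlier domain into a later one. -/
def incl {m n : ℕ} (h : m ≤ n) : M.dom m → M.dom n :=
  Set.inclusion (M.dom_mono h)

/-- `M.Truth φ n a`: the formula `φ` is true at the moment `n` under the assignment `a` of elements
of the domain of that moment; `∀` ranges over the current domain. -/
def Truth : ∀ {k : ℕ}, TFormula L k → ∀ n : ℕ, (Fin k → M.dom n) → Prop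
  | _, .ofFO φ, _, a => φ.Realize Empty.elim a
  | _, .imp φ ψ, n, a => Truth φ n a → Truth ψ n a
  | _, .all φ, n, a => ∀ d : M.dom n, Truth φ n (Fin.snoc a d)
  | _, .next φ, n, a => Truth φ (n + 1) (M.incl (Nat.le_succ n) ∘ a)
  | _, .always φ, n, a => ∀ m, ∀ h : n ≤ m, Truth φ m (M.incl h ∘ a)
  | _, .sometime φ, n, a => ∃ m, ∃ h : n ≤ m, Truth φ m (M.incl h ∘ a)
  | _, .untl φ ψ, n, a => ∃ m, ∃ h : n ≤ m, Truth ψ m (M.incl h ∘ a) ∧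
      ∀ i, ∀ hi : n ≤ i, i < m → Truth φ i (M.incl hi ∘ a)
  | _, .wuntl φ ψ, n, a =>
      (∃ m, ∃ h : n ≤ m, Truth ψ m (M.incl h ∘ a) ∧
        ∀ i, ∀ hi : n ≤ i, i < m → Truth φ i (M.incl hi ∘ a)) ∨
      ∀ m, ∀ h : n ≤ m, Truth φ m (M.incl h ∘ a)

/-- The structure is a model of a closed temporal formula. -/
def Models (φ : TFormula L 0) : Prop :=
  M.Truth φ 0 Fin.elim0

end TemporalStructure

/-! ### Monodic temporal problems -/

/-- A literal whose predicate symbol has arity `k`. -/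
structure Literal (L : FirstOrder.Language.{0, 0}) (k : ℕ) where
  pos : Bool
  rel : L.Relations k

namespace Literal

variable {L : FirstOrder.Language.{0, 0}}

/-- The literal with the given arguments, as a formula. -/
def app {k n : ℕ} (l : Literal L k) (ts : Fin k → L.Term (Empty ⊕ Fin n)) :
    L.BoundedFormula Empty n :=
  match l.pos with
  | true => l.rel.boundedFormula ts
  | false => ∼(l.rel.boundedFormula ts)

/-- A propositional literal `l`, as a closed formula. -/
def prop (l : Literal L 0) : L.Sentence := l.app Fin.elim0

/-- A unary literal `L(x)`. -/
def atVar (l : Literal L 1) : L.BoundedFormula Empty 1 := l.app fun _ => &0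

/-- A unary literal `L(c)`, for a constant `c`. -/
def atConst (l : Literal L 1) (c : L.Constants) : L.Sentence := l.app fun _ => c.term

/-- Transport of a literal along a map of languages. -/
def map {L' : FirstOrder.Language.{0, 0}} (g : L →ᴸ L') {k : ℕ} (l : Literal L k) : Literal L' k :=
  ⟨l.pos, g.onRelation l.rel⟩

end Literal

/-- A temporal step clause: `l ⇒ ○ m` for `k = 0` (ground), `L(x) ⇒ ○ M(x)` for `k = 1`
(non-ground). -/
structure StepClause (L : FirstOrder.Language.{0, 0}) (k : ℕ) where
  lhs : Literal L k
  rhs : Literal L k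

/-- Transport of a step clause along a map of languages. -/
def StepClause.map {L L' : FirstOrder.Language.{0, 0}} (g : L →ᴸ L') {k : ℕ} (s : StepClause L k) :
    StepClause L' k :=
  ⟨s.lhs.map g, s.rhs.map g⟩

/-- The data `⟨U, I, S, E⟩` of a temporal problem. The step part and the eventuality part are split
into their ground and non-ground clauses; a literal in `groundEv` or `ev` stands for the eventuality
clause `◊ l` or `◊ L(x)`. -/
structure TemporalProblem (L : FirstOrder.Language.{0, 0}) where
  univ : Set L.Sentence
  init : Set L.Sentence
  groundStep : Set (StepClause L 0)
  step : Set (StepClause L 1)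
  groundEv : Set (Literal L 0)
  ev : Set (Literal L 1)

namespace TemporalProblem

variable {L : FirstOrder.Language.{0, 0}}

/-- The problem is a monodic temporal problem in divided separated normal form: all parts are
finite, the first-order formulas do not use equality, and no two different step clauses have the
same left-hand side. -/
structure IsDSNF (P : TemporalProblem L) : Prop where
  univ_finite : P.univ.Finite
  init_finite : P.init.Finite
  groundStep_finite : P.groundStep.Finite
  step_finite : P.step.Finite
  groundEv_finite : P.groundEv.Finite
  ev_finite : P.ev.Finite
  univ_eqFree : ∀ φ ∈ P.univ, EqFree φ
  init_eqFree : ∀ φ ∈ P.init, EqFree φ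
  groundStep_injOn : Set.InjOn StepClause.lhs P.groundStep
  step_injOn : Set.InjOn StepClause.lhs P.step

/-- The set of conjuncts of the temporal formula `I ∧ □U ∧ □∀x S ∧ □∀x E` associated with the
problem. -/
def formulas (P : TemporalProblem L) : Set (TFormula L 0) :=
  {ψ | ∃ φ ∈ P.init, ψ = .ofFO φ} ∪
  {ψ | ∃ φ ∈ P.univ, ψ = .always (.ofFO φ)} ∪
  {ψ | ∃ s ∈ P.groundStep,
    ψ = .always (.imp (.ofFO s.lhs.prop) (.next (.ofFO s.rhs.prop)))} ∪
  {ψ | ∃ s ∈ P.step,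
    ψ = .always (.all (.imp (.ofFO s.lhs.atVar) (.next (.ofFO s.rhs.atVar))))} ∪
  {ψ | ∃ l ∈ P.groundEv, ψ = .always (.sometime (.ofFO l.prop))} ∪
  {ψ | ∃ l ∈ P.ev, ψ = .always (.all (.sometime (.ofFO l.atVar)))}

/-- The problem is satisfiable over expanding domains. -/
def Satisfiable (P : TemporalProblem L) : Prop :=
  ∃ M : TemporalStructure.{w} L, ∀ φ ∈ P.formulas, M.Models φ

/-- The constants that occur in the problem. -/
def consts (P : TemporalProblem L) : Set L.Constants :=
  ⋃ φ ∈ P.univ ∪ P.init, formulaConsts φ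

/-- The problem with its universal part replaced by `U`. -/
def withUniv (P : TemporalProblem L) (U : Set L.Sentence) : TemporalProblem L :=
  { P with univ := U }

/-! ### The calculus -/

/-- `P.EDerived Φ Ψ`: the clause `Φ ⇒ ○ Ψ` is an e-derived step clause of `P`. -/
inductive EDerived (P : TemporalProblem L) : L.Sentence → L.Sentence → Prop
  | ex (T : Finset (StepClause L 1)) (hT : ∀ s ∈ T, s ∈ P.step) :
      EDerived P (∃' BoundedFormula.iInf fun s : T => s.1.lhs.atVar)
        (∃' BoundedFormula.iInf fun s : T => s.1.rhs.atVar)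
  | const (s : StepClause L 1) (hs : s ∈ P.step) (c : L.Constants) (hc : c ∈ P.consts) :
      EDerived P (s.lhs.atConst c) (s.rhs.atConst c)

/-- `P.Merged 𝒜 ℬ`: the clause `𝒜 ⇒ ○ ℬ` is obtained by merging a finite set of e-derived step
clauses and original ground step clauses. -/
def Merged (P : TemporalProblem L) (𝒜 ℬ : L.Sentence) : Prop :=
  ∃ T : Finset (L.Sentence × L.Sentence),
    (∀ c ∈ T, P.EDerived c.1 c.2 ∨
      ∃ s ∈ P.groundStep, c.1 = s.lhs.prop ∧ c.2 = s.rhs.prop) ∧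
    𝒜 = BoundedFormula.iInf (fun c : T => c.1.1) ∧
    ℬ = BoundedFormula.iInf (fun c : T => c.1.2)

/-- `P.FullMerged 𝒜 A ℬ B`: the clause `∀x (𝒜 ∧ A(x) ⇒ ○ (ℬ ∧ B(x)))` is a full merged step clause
of `P`. -/
def FullMerged (P : TemporalProblem L) (𝒜 : L.Sentence) (A : L.BoundedFormula Empty 1)
    (ℬ : L.Sentence) (B : L.BoundedFormula Empty 1) : Prop :=
  P.Merged 𝒜 ℬ ∧ ∃ T : Finset (StepClause L 1), (∀ s ∈ T, s ∈ P.step) ∧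
    A = BoundedFormula.iInf (fun s : T => s.1.lhs.atVar) ∧
    B = BoundedFormula.iInf (fun s : T => s.1.rhs.atVar)

/-- `P.Infers φ`: a non-terminating rule, with respect to the current universal part of `P`, has the
conclusion `φ`. -/
inductive Infers (P : TemporalProblem L) : L.Sentence → Prop
  | stepResolution (𝒜 ℬ : L.Sentence) (hm : P.Merged 𝒜 ℬ)
      (hside : ¬ Theory.IsSatisfiable (P.univ ∪ {ℬ})) : Infers P (∼𝒜)
  | eventualityResolution (n : ℕ) (hn : 0 < n) (𝒜 ℬ : Fin n → L.Sentence)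
      (A B : Fin n → L.BoundedFormula Empty 1)
      (hm : ∀ i, P.FullMerged (𝒜 i) (A i) (ℬ i) (B i))
      (l : Literal L 1) (hl : l ∈ P.ev)
      (hloop₁ : ∀ i, Theory.ModelsBoundedFormula P.univ ((weaken (ℬ i) ⊓ B i) ⟹ ∼l.atVar))
      (hloop₂ : ∀ i, Theory.ModelsBoundedFormula P.univ
        ((weaken (ℬ i) ⊓ B i) ⟹ BoundedFormula.iSup fun j => weaken (𝒜 j) ⊓ A j)) :
      Infers P (∀' BoundedFormula.iInf fun i => ∼(weaken (𝒜 i)) ⊔ ∼(A i))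
  | groundEventualityResolution (n : ℕ) (hn : 0 < n) (𝒜 ℬ : Fin n → L.Sentence)
      (hm : ∀ i, P.Merged (𝒜 i) (ℬ i))
      (l : Literal L 0) (hl : l ∈ P.groundEv)
      (hloop₁ : ∀ i, Theory.ModelsBoundedFormula (P.univ ∪ {ℬ i}) (∼l.prop))
      (hloop₂ : ∀ i, Theory.ModelsBoundedFormula (P.univ ∪ {ℬ i}) (BoundedFormula.iSup 𝒜)) :
      Infers P (BoundedFormula.iInf fun i => ∼(𝒜 i))

/-- `P.Terminates`: a termination rule, which derives the contradiction, is applicable with respect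
to the current universal part of `P`. -/
inductive Terminates (P : TemporalProblem L) : Prop
  | initial (h : ¬ Theory.IsSatisfiable (P.univ ∪ P.init)) : Terminates P
  | eventuality (l : Literal L 1) (hl : l ∈ P.ev)
      (h : Theory.ModelsBoundedFormula P.univ (∀' ∼l.atVar)) : Terminates P
  | groundEventuality (l : Literal L 0) (hl : l ∈ P.groundEv)
      (h : Theory.ModelsBoundedFormula P.univ (∼l.prop)) : Terminates P

/-- There is a successfully terminating derivation from `P`: a finite sequence
`U = U₀ ⊆ U₁ ⊆ ⋯ ⊆ Uₙ` of universal parts, each extending the previous one by the conclusion of a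
rule, such that a termination rule applies to `Uₙ`. -/
def HasSuccessfulDerivation (P : TemporalProblem L) : Prop :=
  ∃ (n : ℕ) (U : ℕ → Set L.Sentence), U 0 = P.univ ∧
    (∀ i < n, ∃ φ, (P.withUniv (U i)).Infers φ ∧ U (i + 1) = insert φ (U i)) ∧
    (P.withUniv (U n)).Terminates

end TemporalProblem

/-! ### Constant flooding -/

/-- New propositional symbols, one for every unary literal `L(x)` and every constant `c`. -/
inductive FloodRel (L : FirstOrder.Language.{0, 0}) : ℕ → Type
  | name (l : Literal L 1) (c : L.Constants) : FloodRel L 0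

/-- The language `L` extended by the new propositional symbols. -/
def floodLanguage (L : FirstOrder.Language.{0, 0}) : FirstOrder.Language.{0, 0} :=
  L.sum ⟨fun _ => Empty, FloodRel L⟩

/-- The inclusion of `L` into its extension. -/
def floodIncl (L : FirstOrder.Language.{0, 0}) : L →ᴸ floodLanguage L :=
  LHom.sumInl

/-- The new proposition that renames `L(c)`, as a (positive) literal. -/
def floodLiteral {L : FirstOrder.Language.{0, 0}} (l : Literal L 1) (c : L.Constants) :
    Literal (floodLanguage L) 0 :=
  ⟨true, Sum.inr (FloodRel.name l c)⟩

/-- The constant flooded form of `P`: the eventualities `◊ L(c)` are added, for all non-ground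
eventualities `◊ L(x)` and all constants `c` of `P`. To stay in the normal form, `L(c)` is renamed
by a new proposition `l`: the eventuality `◊ l` and the universal formula `l ⇒ L(c)` are added. -/
def TemporalProblem.flooded {L : FirstOrder.Language.{0, 0}} (P : TemporalProblem L) :
    TemporalProblem (floodLanguage L) where
  univ := (floodIncl L).onSentence '' P.univ ∪
    {φ | ∃ l ∈ P.ev, ∃ c ∈ P.consts,
      φ = (floodLiteral l c).prop ⟹ (floodIncl L).onSentence (l.atConst c)}
  init := (floodIncl L).onSentence '' P.init
  groundStep := StepClause.map (floodIncl L) '' P.groundStep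
  step := StepClause.map (floodIncl L) '' P.step
  groundEv := Literal.map (floodIncl L) '' P.groundEv ∪
    {l' | ∃ l ∈ P.ev, ∃ c ∈ P.consts, l' = floodLiteral l c}
  ev := Literal.map (floodIncl L) '' P.ev

end FOTL

/-! Correctness is pointwise: in a temporal model of the problem, the conclusion of every rule holds
at every moment (`Infers.realize`). A merged clause carries its left-hand side from one moment to
its right-hand side at the next, because an existential witness survives into the larger domain and
constants are rigid. A loop of clauses therefore perpetuates itself and forbids its literal at all
later moments, against the eventuality.

For completeness, consider the graph whose vertices are the first-order models of a derived
universal part `U`, with an edge from one model to another if the second satisfies the right-hand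
sides of all base clauses triggered in the first. The edges out of a model depend only on its clause
type, and there are finitely many types. Choose `U` derivable with as few realised types as possible
(`exists_saturated`); then no rule can exclude a type. Applied to step resolution this says that
every model has a successor; applied to the two eventuality rules it says that from every model, and
from every element of a model, each eventuality can be reached.

If no derivation terminates, `U` together with the initial part has a model. A genericity argument
(`exists_generic_path`) extends it to an infinite sequence of models in which the ground
eventualities recur and every element can reach every eventuality. A second use of the same argument
inside this sequence puts every element on a fair run. The fair runs are the elements of the
temporal model (`satisfiable_of_fairRuns`): evaluating runs at a moment is surjective and respects
predicates, so it preserves equality-free truth. The course of a constant is prescribed and cannot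
be steered; constant flooding is what makes it fair. -/

namespace FOTL

open FirstOrder FirstOrder.Language

/-! ### Semantics of literals and of the formulas built by the rules -/

section Semantics

variable {L : FirstOrder.Language.{0, 0}} {M : Type*} [L.Structure M]

/-- The literal is true at the given elements of a structure. -/
def Literal.Holds {k : ℕ} (l : Literal L k) (xs : Fin k → M) : Prop :=
  Structure.RelMap l.rel xs ↔ l.pos = true

theorem Literal.realize_app {k n : ℕ} (l : Literal L k) (ts : Fin k → L.Term (Empty ⊕ Fin n))
    (v : Empty → M) (xs : Fin n → M) :
    (l.app ts).Realize v xs ↔ l.Holds fun i => (ts i).realize (Sum.elim v xs) := by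
  obtain ⟨_ | _, r⟩ := l <;> simp [Literal.app, Literal.Holds, BoundedFormula.realize_rel]

theorem Literal.realize_atVar (l : Literal L 1) (v : Empty → M) (xs : Fin 1 → M) :
    l.atVar.Realize v xs ↔ l.Holds fun _ => xs 0 := by
  simp [Literal.atVar, Literal.realize_app]

theorem Literal.realize_atConst (l : Literal L 1) (c : L.Constants) :
    M ⊨ l.atConst c ↔ l.Holds fun _ => (c : M) := by
  simp [Sentence.Realize, Formula.Realize, Literal.atConst, Literal.realize_app]

theorem Literal.realize_prop (l : Literal L 0) :
    M ⊨ l.prop ↔ l.Holds (Fin.elim0 : Fin 0 → M) := by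
  simp [Sentence.Realize, Formula.Realize, Literal.prop, Literal.realize_app,
    Subsingleton.elim _ (Fin.elim0 : Fin 0 → M)]

theorem realize_weaken (φ : L.Sentence) (v : Empty → M) (xs : Fin 1 → M) :
    (weaken φ).Realize v xs ↔ M ⊨ φ := by
  rw [weaken, BoundedFormula.realize_liftAt le_rfl, Sentence.Realize, Formula.Realize,
    Subsingleton.elim v default]
  exact iff_of_eq (congrArg _ (Subsingleton.elim _ _))

theorem realize_sentence_iff_boundedFormula (φ : L.Sentence) (v : Empty → M) (xs : Fin 0 → M) :
    BoundedFormula.Realize φ v xs ↔ M ⊨ φ := by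
  rw [Sentence.Realize, Formula.Realize, Subsingleton.elim v default, Subsingleton.elim xs default]

theorem realize_sentence_iInf {β : Type} [Finite β] (f : β → L.Sentence) :
    M ⊨ (BoundedFormula.iInf f : L.Sentence) ↔ ∀ b, M ⊨ f b := by
  simp only [Sentence.Realize, Formula.Realize, BoundedFormula.realize_iInf]

theorem realize_sentence_iSup {β : Type} [Finite β] (f : β → L.Sentence) :
    M ⊨ (BoundedFormula.iSup f : L.Sentence) ↔ ∃ b, M ⊨ f b := by
  simp only [Sentence.Realize, Formula.Realize, BoundedFormula.realize_iSup]

theorem realize_ex_iInf_atVar {T : Finset (StepClause L 1)} (f : StepClause L 1 → Literal L 1) :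
    M ⊨ (∃' BoundedFormula.iInf fun s : T => (f s.1).atVar : L.Sentence) ↔
      ∃ d : M, ∀ s ∈ T, (f s).Holds fun _ => d := by
  simp only [Sentence.Realize, Formula.Realize, BoundedFormula.realize_ex,
    BoundedFormula.realize_iInf, Literal.realize_atVar, Subtype.forall]
  rfl

theorem realize_all_not_or {n : ℕ} (A : Fin n → L.Sentence)
    (B : Fin n → L.BoundedFormula Empty 1) :
    M ⊨ (∀' BoundedFormula.iInf fun i => ∼(weaken (A i)) ⊔ ∼(B i) : L.Sentence) ↔
      ∀ (d : M) (i : Fin n), M ⊨ A i → ¬ (B i).Realize Empty.elim fun _ => d := by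
  simp only [Sentence.Realize, Formula.Realize, BoundedFormula.realize_all,
    BoundedFormula.realize_iInf, BoundedFormula.realize_sup, BoundedFormula.realize_not,
    realize_weaken]
  refine forall_congr' fun d => forall_congr' fun i => ?_
  rw [show (Fin.snoc default d : Fin 1 → M) = fun _ => d from
      funext fun j => by simp [Fin.snoc],
    Subsingleton.elim (default : Empty → M) Empty.elim]
  tauto

theorem model_insert {T : L.Theory} {φ : L.Sentence} : M ⊨ (insert φ T : L.Theory) ↔
    M ⊨ φ ∧ M ⊨ T := by
  simp [Theory.model_iff]

theorem model_union_singleton {T : L.Theory} {φ : L.Sentence} : M ⊨ (T ∪ {φ} : L.Theory) ↔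
    M ⊨ T ∧ M ⊨ φ := by
  simp [Theory.model_iff, and_comm]

end Semantics

/-! ### Models of a problem, moment by moment -/

namespace TemporalStructure

variable {L : FirstOrder.Language.{0, 0}}

instance (M : TemporalStructure.{w} L) (n : ℕ) : Nonempty (M.dom n) := M.dom_nonempty n

/-- The structure satisfies all conjuncts of the temporal formula of the problem. -/
structure IsModelOf (M : TemporalStructure.{w} L) (P : TemporalProblem L) : Prop where
  init : ∀ φ ∈ P.init, M.dom 0 ⊨ φ
  univ : ∀ n, ∀ φ ∈ P.univ, M.dom n ⊨ φ
  groundStep : ∀ s ∈ P.groundStep, ∀ n, M.dom n ⊨ s.lhs.prop → M.dom (n + 1) ⊨ s.rhs.prop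
  step : ∀ s ∈ P.step, ∀ n, ∀ d : M.dom n, (s.lhs.Holds fun _ => d) →
    s.rhs.Holds fun _ => M.incl (Nat.le_succ n) d
  groundEv : ∀ l ∈ P.groundEv, ∀ n, ∃ m, n ≤ m ∧ M.dom m ⊨ l.prop
  ev : ∀ l ∈ P.ev, ∀ n, ∀ d : M.dom n, ∃ m, ∃ h : n ≤ m, l.Holds fun _ => M.incl h d

theorem isModelOf_iff (M : TemporalStructure.{w} L) (P : TemporalProblem L) :
    M.IsModelOf P ↔ ∀ φ ∈ P.formulas, M.Models φ := by
  have key : (∀ φ ∈ P.formulas, M.Models φ) ↔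
      (∀ φ ∈ P.init, M.Models (.ofFO φ)) ∧ (∀ φ ∈ P.univ, M.Models (.always (.ofFO φ))) ∧
      (∀ s ∈ P.groundStep,
        M.Models (.always (.imp (.ofFO s.lhs.prop) (.next (.ofFO s.rhs.prop))))) ∧
      (∀ s ∈ P.step,
        M.Models (.always (.all (.imp (.ofFO s.lhs.atVar) (.next (.ofFO s.rhs.atVar)))))) ∧
      (∀ l ∈ P.groundEv, M.Models (.always (.sometime (.ofFO l.prop)))) ∧
      (∀ l ∈ P.ev, M.Models (.always (.all (.sometime (.ofFO l.atVar))))) := by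
    constructor
    · intro h
      refine ⟨?_, ?_, ?_, ?_, ?_, ?_⟩ <;> intro x hx <;> apply h <;>
        simp only [TemporalProblem.formulas, Set.mem_union, Set.mem_ofPred_eq]
      · exact .inl (.inl (.inl (.inl (.inl ⟨x, hx, rfl⟩))))
      · exact .inl (.inl (.inl (.inl (.inr ⟨x, hx, rfl⟩))))
      · exact .inl (.inl (.inl (.inr ⟨x, hx, rfl⟩)))
      · exact .inl (.inl (.inr ⟨x, hx, rfl⟩))
      · exact .inl (.inr ⟨x, hx, rfl⟩)
      · exact .inr ⟨x, hx, rfl⟩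
    · rintro ⟨h1, h2, h3, h4, h5, h6⟩ φ
        (((((⟨x, hx, rfl⟩ | ⟨x, hx, rfl⟩) | ⟨x, hx, rfl⟩) | ⟨x, hx, rfl⟩) | ⟨x, hx, rfl⟩) |
          ⟨x, hx, rfl⟩)
      exacts [h1 x hx, h2 x hx, h3 x hx, h4 x hx, h5 x hx, h6 x hx]
  have snoc : ∀ (n : ℕ) (h : 0 ≤ n) (d : M.dom n),
      (Fin.snoc (M.incl h ∘ Fin.elim0) d : Fin 1 → M.dom n) 0 = d := fun n h d => by
    simp [Fin.snoc]
  rw [key]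
  simp only [Models, Truth, realize_sentence_iff_boundedFormula, Literal.realize_atVar,
    Function.comp_apply, snoc, Nat.zero_le, forall_true_left]
  constructor
  · rintro ⟨h1, h2, h3, h4, h5, h6⟩
    refine ⟨h1, fun φ hφ n => h2 n φ hφ, h3, h4, fun l hl n => ?_, h6⟩
    obtain ⟨m, hm, h⟩ := h5 l hl n
    exact ⟨m, hm, h⟩
  · rintro ⟨h1, h2, h3, h4, h5, h6⟩
    refine ⟨h1, fun n φ hφ => h2 φ hφ n, h3, h4, fun l hl n => ?_, h6⟩
    obtain ⟨m, hm, h⟩ := h5 l hl n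
    exact ⟨m, hm, h⟩

end TemporalStructure

namespace TemporalProblem

variable {L : FirstOrder.Language.{0, 0}} {P : TemporalProblem L}

theorem satisfiable_iff : P.Satisfiable.{w} ↔ ∃ M : TemporalStructure.{w} L, M.IsModelOf P := by
  simp only [Satisfiable, TemporalStructure.isModelOf_iff]

/-! ### Correctness of the rules -/

section Correctness

variable {M : TemporalStructure.{w} L}

theorem _root_.FOTL.TemporalStructure.incl_const (c : L.Constants) {m n : ℕ} (h : m ≤ n) :
    M.incl h (c : M.dom m) = (c : M.dom n) := by
  apply Subtype.ext
  exact M.rigid c m n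

/-- Inclusion of domains moves the existential witness, and rigidity the constant, to the next
moment. A universal clause would fail here, since elements born at `n + 1` have no past. -/
theorem EDerived.realize_next (hM : M.IsModelOf P) {A B : L.Sentence} (h : P.EDerived A B) (n : ℕ)
    (hA : M.dom n ⊨ A) : M.dom (n + 1) ⊨ B := by
  cases h with
  | ex T hT =>
    obtain ⟨d, hd⟩ := (realize_ex_iInf_atVar fun s => s.lhs).1 hA
    exact (realize_ex_iInf_atVar fun s => s.rhs).2
      ⟨M.incl (Nat.le_succ n) d, fun s hs => hM.step s (hT s hs) n d (hd s hs)⟩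
  | const s hs c hc =>
    rw [Literal.realize_atConst] at hA ⊢
    rw [← M.incl_const c (Nat.le_succ n)]
    exact hM.step s hs n _ hA

theorem Merged.realize_next (hM : M.IsModelOf P) {A B : L.Sentence} (h : P.Merged A B) (n : ℕ)
    (hA : M.dom n ⊨ A) : M.dom (n + 1) ⊨ B := by
  obtain ⟨T, hT, rfl, rfl⟩ := h
  rw [realize_sentence_iInf] at hA ⊢
  rintro ⟨c, hc⟩
  have hc' := hA ⟨c, hc⟩
  rcases hT c hc with h | ⟨s, hs, h1, h2⟩
  · exact h.realize_next hM n hc'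
  · simp only [h1, h2] at hc' ⊢
    exact hM.groundStep s hs n hc'

theorem realize_iInf_lhs {N : Type*} [L.Structure N] (T : Finset (StepClause L 1))
    (f : StepClause L 1 → Literal L 1) (v : Empty → N) (xs : Fin 1 → N) :
    (BoundedFormula.iInf fun s : T => (f s.1).atVar).Realize v xs ↔
      ∀ s ∈ T, (f s).Holds fun _ => xs 0 := by
  simp only [BoundedFormula.realize_iInf, Literal.realize_atVar, Subtype.forall]

theorem FullMerged.realize_next (hM : M.IsModelOf P) {A B : L.Sentence}
    {A' B' : L.BoundedFormula Empty 1} (h : P.FullMerged A A' B B') (n : ℕ) (d : M.dom n)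
    (hA : M.dom n ⊨ A) (hA' : A'.Realize Empty.elim fun _ => d) :
    M.dom (n + 1) ⊨ B ∧ B'.Realize Empty.elim fun _ => M.incl (Nat.le_succ n) d := by
  obtain ⟨hm, T, hT, rfl, rfl⟩ := h
  refine ⟨hm.realize_next hM n hA, ?_⟩
  rw [realize_iInf_lhs T fun s => s.lhs] at hA'
  rw [realize_iInf_lhs T fun s => s.rhs]
  exact fun s hs => hM.step s (hT s hs) n d (hA' s hs)

theorem Infers.realize (hM : M.IsModelOf P) {φ : L.Sentence} (h : P.Infers φ) (n : ℕ) :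
    M.dom n ⊨ φ := by
  have hU : ∀ n, M.dom n ⊨ (P.univ : L.Theory) := fun n => ⟨fun φ hφ => hM.univ n φ hφ⟩
  cases h with
  | stepResolution A B hm hside =>
    rw [Sentence.realize_not]
    intro hA
    have := model_union_singleton.2 ⟨hU (n + 1), hm.realize_next hM n hA⟩
    exact hside (Theory.Model.isSatisfiable (M.dom (n + 1)))
  | eventualityResolution k hk A B A' B' hm l hl h1 h2 =>
    rw [realize_all_not_or]
    intro d i hi hi'
    -- Once the loop is entered by `d`, some left-hand side of it holds of `d` at every later
    -- moment.
    have key : ∀ j, ∃ h : n ≤ n + j, ∃ i, M.dom (n + j) ⊨ A i ∧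
        (A' i).Realize Empty.elim fun _ => M.incl h d := by
      intro j
      induction j with
      | zero => exact ⟨le_rfl, i, hi, hi'⟩
      | succ j ih =>
        obtain ⟨h, i, hi, hi'⟩ := ih
        have := hU (n + j + 1)
        have hB := (hm i).realize_next hM (n + j) _ hi hi'
        have := (h2 i).realize_boundedFormula (M.dom (n + j + 1)) (v := Empty.elim)
          (xs := fun _ => M.incl (Nat.le_succ _) (M.incl h d))
        simp only [BoundedFormula.realize_imp, BoundedFormula.realize_inf, realize_weaken,
          BoundedFormula.realize_iSup] at this
        exact ⟨h.trans (Nat.le_succ _), this hB⟩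
    -- The eventuality is invoked at `n + 1`, because the loop refutes the literal only after at
    -- least one step.
    obtain ⟨m, h, hml⟩ := hM.ev l hl (n + 1) (M.incl (Nat.le_succ n) d)
    obtain ⟨j, rfl⟩ : ∃ j, m = n + j + 1 := ⟨m - n - 1, by omega⟩
    obtain ⟨h', i, hi, hi'⟩ := key j
    have := hU (n + j + 1)
    have hB := (hm i).realize_next hM (n + j) _ hi hi'
    have := (h1 i).realize_boundedFormula (M.dom (n + j + 1)) (v := Empty.elim)
      (xs := fun _ => M.incl (Nat.le_succ _) (M.incl h' d))
    simp only [BoundedFormula.realize_imp, BoundedFormula.realize_inf, realize_weaken,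
      BoundedFormula.realize_not, Literal.realize_atVar] at this
    exact this hB hml
  | groundEventualityResolution k hk A B hm l hl h1 h2 =>
    rw [realize_sentence_iInf]
    intro i
    rw [Sentence.realize_not]
    intro hi
    have key : ∀ j, ∃ i, M.dom (n + j) ⊨ A i := by
      intro j
      induction j with
      | zero => exact ⟨i, hi⟩
      | succ j ih =>
        obtain ⟨i, hi⟩ := ih
        have := model_union_singleton.2 ⟨hU (n + j + 1), (hm i).realize_next hM (n + j) hi⟩
        exact (realize_sentence_iSup A).1 ((h2 i).realize_sentence (M.dom (n + j + 1)))
    obtain ⟨m, h, hml⟩ := hM.groundEv l hl (n + 1)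
    obtain ⟨j, rfl⟩ : ∃ j, m = n + j + 1 := ⟨m - n - 1, by omega⟩
    obtain ⟨i, hi⟩ := key j
    have := model_union_singleton.2 ⟨hU (n + j + 1), (hm i).realize_next hM (n + j) hi⟩
    exact (Sentence.realize_not _).1 ((h1 i).realize_sentence (M.dom (n + j + 1))) hml

theorem Infers.satisfiable {φ : L.Sentence} (h : P.Infers φ) (hP : P.Satisfiable.{w}) :
    (P.withUniv (insert φ P.univ)).Satisfiable.{w} := by
  rw [satisfiable_iff] at hP ⊢
  obtain ⟨M, hM⟩ := hP
  refine ⟨M, hM.init, fun n ψ hψ => ?_, hM.groundStep, hM.step, hM.groundEv, hM.ev⟩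
  rcases hψ with rfl | hψ
  exacts [h.realize hM n, hM.univ n ψ hψ]

theorem Terminates.not_satisfiable (h : P.Terminates) : ¬ P.Satisfiable.{w} := by
  rw [satisfiable_iff]
  rintro ⟨M, hM⟩
  have hU : ∀ n, M.dom n ⊨ (P.univ : L.Theory) := fun n => ⟨fun φ hφ => hM.univ n φ hφ⟩
  cases h with
  | initial h =>
    have : M.dom 0 ⊨ (P.univ ∪ P.init : L.Theory) :=
      Theory.model_union_iff.2 ⟨hU 0, ⟨fun φ hφ => hM.init φ hφ⟩⟩
    exact h (Theory.Model.isSatisfiable (M.dom 0))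
  | eventuality l hl h =>
    obtain ⟨d⟩ := M.dom_nonempty 0
    obtain ⟨m, hm, hml⟩ := hM.ev l hl 0 d
    have := hU m
    have := h.realize_boundedFormula (M.dom m) (v := Empty.elim) (xs := Fin.elim0)
    simp only [BoundedFormula.realize_all, BoundedFormula.realize_not, Literal.realize_atVar]
      at this
    exact this (M.incl hm d) (by simpa [Fin.snoc] using hml)
  | groundEventuality l hl h =>
    obtain ⟨m, hm, hml⟩ := hM.groundEv l hl 0
    have := hU m
    exact (Sentence.realize_not _).1 (h.realize_sentence (M.dom m)) hml

theorem HasSuccessfulDerivation.not_satisfiable (h : P.HasSuccessfulDerivation) :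
    ¬ P.Satisfiable.{w} := by
  intro hP
  obtain ⟨n, U, h0, hstep, hterm⟩ := h
  have key : ∀ i ≤ n, (P.withUniv (U i)).Satisfiable.{w} := by
    intro i
    induction i with
    | zero => rw [h0]; exact fun _ => hP
    | succ i ih =>
      intro hi
      obtain ⟨φ, hφ, h⟩ := hstep i hi
      rw [h]
      exact hφ.satisfiable (ih (by omega))
  exact hterm.not_satisfiable (key n le_rfl)

end Correctness

end TemporalProblem

/-! ### Generic infinite paths -/

section GenericPaths

variable {α : ℕ → Type*}

/-- A finite path `a = f k, f (k + 1), …, f len` of a relation between consecutive levels. -/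
structure FinPath (R : ∀ n, α n → α (n + 1) → Prop) (k : ℕ) (a : α k) where
  len : ℕ
  toFun : ∀ n, α n
  le_len : k ≤ len
  start : toFun k = a
  rel : ∀ n, k ≤ n → n < len → R n (toFun n) (toFun (n + 1))

variable {R : ∀ n, α n → α (n + 1) → Prop} {k : ℕ}

instance {a : α k} : Preorder (FinPath R k a) where
  le p q := p.len ≤ q.len ∧ ∀ n ≤ p.len, q.toFun n = p.toFun n
  le_refl p := ⟨le_rfl, fun _ _ => rfl⟩
  le_trans p q r h h' := ⟨h.1.trans h'.1, fun n hn => (h'.2 n (hn.trans h.1)).trans (h.2 n hn)⟩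

theorem FinPath.exists_le_len {a : α k} (hR : ∀ n a, ∃ b, R n a b) (p : FinPath R k a) (N : ℕ) :
    ∃ q, p ≤ q ∧ N ≤ q.len := by
  induction N with
  | zero => exact ⟨p, le_rfl, Nat.zero_le _⟩
  | succ N ih =>
    obtain ⟨q, hpq, hq⟩ := ih
    obtain ⟨b, hb⟩ := hR _ (q.toFun q.len)
    have hne : ∀ n ≤ q.len, n ≠ q.len + 1 := fun n hn => by omega
    refine ⟨⟨q.len + 1, Function.update q.toFun (q.len + 1) b, q.le_len.trans (Nat.le_succ _), ?_,
      fun n hkn hn => ?_⟩, hpq.trans ⟨Nat.le_succ _, fun n hn => ?_⟩, Nat.succ_le_succ hq⟩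
    · rw [Function.update_of_ne (hne k q.le_len), q.start]
    · rw [Function.update_of_ne (hne n (by omega))]
      rcases Nat.lt_or_ge n q.len with h | h
      · rw [Function.update_of_ne (by omega)]
        exact q.rel n hkn h
      · obtain rfl : n = q.len := by omega
        simpa using hb
    · exact Function.update_of_ne (hne n hn) _ _

/-- If countably many properties of finite paths can be reached from every sufficiently long finite
path, then there is an infinite path with all these properties. -/
theorem exists_generic_path [∀ n, Nonempty (α n)] {ι : Type*} [Countable ι]
    (hR : ∀ n a, ∃ b, R n a b) (a : α k) (Q : ι → (∀ n, α n) → ℕ → Prop) (B : ι → ℕ)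
    (hQ : ∀ i f g N, (∀ n ≤ N, f n = g n) → Q i f N → Q i g N)
    (hext : ∀ i (f : ∀ n, α n) N, B i ≤ N → k ≤ N → (∀ n, k ≤ n → n < N → R n (f n) (f (n + 1))) →
      ∃ (g : ∀ n, α n) (N' : ℕ), N ≤ N' ∧ (∀ n ≤ N, g n = f n) ∧
        (∀ n, k ≤ n → n < N' → R n (g n) (g (n + 1))) ∧ Q i g N') :
    ∃ f : ∀ n, α n, f k = a ∧ (∀ n, k ≤ n → R n (f n) (f (n + 1))) ∧ ∀ i, ∃ N, Q i f N := by
  classical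
  have := Encodable.ofCountable ι
  -- Rasiowa–Sikorski: being long is a cofinal condition by `hR`, and so is each property, after
  -- first lengthening the path to `B i`. An increasing sequence of paths meets all these
  -- conditions.
  let D : ℕ ⊕ ι → Order.Cofinal (FinPath R k a)
    | .inl N => ⟨{p | N ≤ p.len}, fun p => by
        obtain ⟨q, h, h'⟩ := p.exists_le_len hR N
        exact ⟨q, h', h⟩⟩
    | .inr i => ⟨{p | Q i p.toFun p.len}, fun p => by
        obtain ⟨q, h, h'⟩ := p.exists_le_len hR (B i)
        obtain ⟨g, N', h1, h2, h3, h4⟩ := hext i q.toFun q.len h' q.le_len q.rel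
        exact ⟨⟨N', g, q.le_len.trans h1, (h2 k q.le_len).trans q.start, h3⟩, h4,
          h.trans ⟨h1, h2⟩⟩⟩
  let p₀ : FinPath R k a := ⟨k, Function.update (fun _ => Classical.arbitrary _) k a, le_rfl,
    by simp, fun n h h' => absurd h' (by omega)⟩
  let s := Order.sequenceOfCofinals p₀ D
  have hs : Monotone s := Order.sequenceOfCofinals.monotone p₀ D
  -- A stage at which the value at `n` is settled: the condition encoded by `i` is met at stage `i +
  -- 1`.
  let t : ℕ → ℕ := fun n => Encodable.encode (Sum.inl n : ℕ ⊕ ι) + 1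
  have ht : ∀ n, n ≤ (s (t n)).len := fun n => Order.sequenceOfCofinals.encode_mem p₀ D (.inl n)
  have agree : ∀ i n, n ≤ (s i).len → (s (t n)).toFun n = (s i).toFun n := by
    intro i n hn
    rcases le_total i (t n) with h | h
    · exact (hs h).2 n hn
    · exact ((hs h).2 n (ht n)).symm
  refine ⟨fun n => (s (t n)).toFun n, (s (t k)).start, fun n hn => ?_, fun i => ?_⟩
  · change R n ((s (t n)).toFun n) ((s (t (n + 1))).toFun (n + 1))
    rw [agree (t (n + 1)) n ((Nat.le_succ n).trans (ht (n + 1)))]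
    exact (s (t (n + 1))).rel n hn (ht (n + 1))
  · have h := Order.sequenceOfCofinals.encode_mem p₀ D (.inr i)
    exact ⟨_, hQ i _ _ _ (fun n hn => (agree _ n hn).symm) h⟩

end GenericPaths

/-! ### Equality-free formulas and surjections -/

section Transfer

variable {L : FirstOrder.Language.{0, 0}} [∀ n, IsEmpty (L.Functions (n + 1))]
  {N M : Type*} [L.Structure N] [L.Structure M]

theorem realize_term_map (f : N → M) {n : ℕ} (t : L.Term (Empty ⊕ Fin n))
    (hc : ∀ c ∈ termConsts t, f (c : N) = (c : M)) (xs : Fin n → N) :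
    f (t.realize (Sum.elim Empty.elim xs)) = t.realize (Sum.elim Empty.elim (f ∘ xs)) := by
  cases t with
  | var x =>
    rcases x with e | i
    · exact e.elim
    · rfl
  | @func k c ts =>
    cases k with
    | zero =>
      have := hc c (by simp [termConsts])
      simp only [Term.realize]
      rw [Subsingleton.elim (fun i => (ts i).realize (Sum.elim Empty.elim xs)) default,
        Subsingleton.elim (fun i => (ts i).realize (Sum.elim Empty.elim (f ∘ xs))) default]
      exact this
    | succ k => exact isEmptyElim c

/-- The truth of an equality-free formula is reflected by surjections that preserve and reflect
the predicates and preserve the constants of the formula. -/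
theorem realize_iff_of_surjective (f : N → M) (hf : Function.Surjective f)
    (hR : ∀ {k : ℕ} (r : L.Relations k) (xs : Fin k → N),
      Structure.RelMap r xs ↔ Structure.RelMap r (f ∘ xs))
    {n : ℕ} (φ : L.BoundedFormula Empty n) (he : EqFree φ)
    (hc : ∀ c ∈ formulaConsts φ, f (c : N) = (c : M)) (xs : Fin n → N) :
    φ.Realize Empty.elim xs ↔ φ.Realize Empty.elim (f ∘ xs) := by
  induction φ with
  | falsum => exact Iff.rfl
  | equal => exact he.elim
  | rel r ts =>
    simp only [BoundedFormula.Realize]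
    rw [hR]
    refine iff_of_eq (congrArg _ (funext fun i => ?_))
    exact realize_term_map f (ts i) (fun c h => hc c (Set.mem_iUnion.2 ⟨i, h⟩)) xs
  | imp φ ψ ih₁ ih₂ =>
    exact imp_congr (ih₁ he.1 (fun c h => hc c (.inl h)) xs)
      (ih₂ he.2 (fun c h => hc c (.inr h)) xs)
  | all φ ih =>
    simp only [BoundedFormula.realize_all]
    rw [hf.forall]
    refine forall_congr' fun d => ?_
    rw [ih he hc, Fin.comp_snoc]

end Transfer

/-! ### The temporal model made of fair runs -/

namespace TemporalProblem

variable {L : FirstOrder.Language.{0, 0}} (P : TemporalProblem L)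

/-- The element `d'` satisfies what the step clauses demand of the successor of `d`. -/
def StepRel {M N : Type*} [L.Structure M] [L.Structure N] (d : M) (d' : N) : Prop :=
  ∀ s ∈ P.step, (s.lhs.Holds fun _ => d) → s.rhs.Holds fun _ => d'

/-- From the moment `k` on, the sequence of elements respects the step clauses, and it fulfils each
eventuality infinitely often. -/
def FairRun {M : ℕ → Type*} [∀ n, L.Structure (M n)] (k : ℕ) (r : ∀ n, M n) : Prop :=
  (∀ n, k ≤ n → P.StepRel (r n) (r (n + 1))) ∧
    ∀ l ∈ P.ev, ∀ n, ∃ m, n ≤ m ∧ l.Holds fun _ => r m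

variable {P}

/-- A sequence of first-order structures in which every element lies on a fair run yields a model
over expanding domains, whose elements are the fair runs. -/
theorem satisfiable_of_fairRuns [∀ n, IsEmpty (L.Functions (n + 1))] (hP : P.IsDSNF)
    (M : ℕ → Type) [∀ n, L.Structure (M n)] [∀ n, Nonempty (M n)]
    (hinit : ∀ φ ∈ P.init, M 0 ⊨ φ) (huniv : ∀ n, ∀ φ ∈ P.univ, M n ⊨ φ)
    (hstep : ∀ s ∈ P.groundStep, ∀ n, M n ⊨ s.lhs.prop → M (n + 1) ⊨ s.rhs.prop)
    (hev : ∀ l ∈ P.groundEv, ∀ n, ∃ m, n ≤ m ∧ M m ⊨ l.prop)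
    (hruns : ∀ n (d : M n), ∃ r : ∀ n, M n, P.FairRun n r ∧ r n = d)
    (hconst : ∀ c ∈ P.consts, P.FairRun 0 fun n => (c : M n)) :
    P.Satisfiable.{w} := by
  classical
  -- An element is a moment of birth together with a run. Several runs may pass through one point of
  -- `M n`, which is harmless without equality.
  let C : Type w := ULift (ℕ × ∀ n, M n)
  let dom : ℕ → Set C := fun n => {x | x.down.1 ≤ n ∧ P.FairRun x.down.1 x.down.2}
  have mono : Monotone dom := fun m n h x hx => ⟨hx.1.trans h, hx.2⟩
  obtain ⟨r₀, hr₀, -⟩ := hruns 0 (Classical.arbitrary _)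
  let base : dom 0 := ⟨⟨0, r₀⟩, le_rfl, hr₀⟩
  -- A constant of the problem has to be the run of its own values; any other constant occurs in no
  -- formula to be transferred, so a default run serves.
  let point : L.Constants → dom 0 := fun c =>
    if hc : c ∈ P.consts then ⟨⟨0, fun n => (c : M n)⟩, le_rfl, hconst c hc⟩ else base
  let eval : ∀ n, dom n → M n := fun n x => x.1.down.2 n
  let str : ∀ n, L.Structure (dom n) := fun n =>
    { funMap := fun {k} f _ => match k, f with
        | 0, c => Set.inclusion (mono (Nat.zero_le n)) (point c)
        | _ + 1, f => isEmptyElim f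
      RelMap := fun r xs => Structure.RelMap r (eval n ∘ xs) }
  let T : TemporalStructure.{w} L :=
    { Carrier := C
      dom := dom
      dom_nonempty := fun n => ⟨Set.inclusion (mono (Nat.zero_le n)) base⟩
      dom_mono := mono
      str := str
      rigid := fun c m n => rfl }
  have surj : ∀ n, Function.Surjective (eval n) := by
    intro n d
    obtain ⟨r, hr, hd⟩ := hruns n d
    exact ⟨⟨⟨n, r⟩, le_rfl, hr⟩, hd⟩
  have hc : ∀ n, ∀ c ∈ P.consts, eval n ((c : T.dom n)) = (c : M n) := by
    intro n c hc
    change (point c).1.down.2 n = _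
    simp only [point, dif_pos hc]
  have holds : ∀ {k : ℕ} (l : Literal L k) (n : ℕ) (xs : Fin k → T.dom n),
      l.Holds xs ↔ l.Holds (eval n ∘ xs) := fun l n xs => Iff.rfl
  have transfer : ∀ n, ∀ φ ∈ P.univ ∪ P.init, M n ⊨ φ → T.dom n ⊨ φ := by
    intro n φ hφ h
    have he : EqFree φ := hφ.elim (hP.univ_eqFree φ) (hP.init_eqFree φ)
    rw [← realize_sentence_iff_boundedFormula φ Empty.elim Fin.elim0]
    rw [realize_iff_of_surjective (eval n) (surj n) (fun r xs => Iff.rfl) φ he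
      (fun c h => hc n c (Set.mem_biUnion hφ h)), realize_sentence_iff_boundedFormula]
    exact h
  have prop : ∀ n (l : Literal L 0), T.dom n ⊨ l.prop ↔ M n ⊨ l.prop := by
    intro n l
    rw [Literal.realize_prop, Literal.realize_prop, holds,
      Subsingleton.elim (eval n ∘ Fin.elim0) Fin.elim0]
  rw [satisfiable_iff]
  refine ⟨T, fun φ hφ => transfer 0 φ (.inr hφ) (hinit φ hφ),
    fun n φ hφ => transfer n φ (.inl hφ) (huniv n φ hφ), fun s hs n h => ?_,
    fun s hs n d h => ?_, fun l hl n => ?_, fun l hl n d => ?_⟩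
  · exact (prop _ _).2 (hstep s hs n ((prop _ _).1 h))
  · exact d.2.2.1 n d.2.1 s hs h
  · obtain ⟨m, h, h'⟩ := hev l hl n
    exact ⟨m, h, (prop _ _).2 h'⟩
  · obtain ⟨m, h, h'⟩ := d.2.2.2 l hl n
    exact ⟨m, h, h'⟩

end TemporalProblem

/-! ### Concatenation of finite paths -/

theorem exists_seq_of_transGen {α : Type*} {r : α → α → Prop} {a b : α}
    (h : Relation.TransGen r a b) :
    ∃ (g : ℕ → α) (j : ℕ), 0 < j ∧ g 0 = a ∧ g j = b ∧ ∀ i < j, r (g i) (g (i + 1)) := by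
  induction h using Relation.TransGen.head_induction_on with
  | @single a h =>
    refine ⟨fun i => Nat.casesOn i a fun _ => b, 1, one_pos, rfl, rfl, fun i hi => ?_⟩
    obtain rfl : i = 0 := by omega
    exact h
  | @head a c h _ ih =>
    obtain ⟨g, j, -, h0, hj, hg⟩ := ih
    refine ⟨fun i => Nat.casesOn i a g, j + 1, Nat.succ_pos _, rfl, hj, fun i hi => ?_⟩
    cases i with
    | zero =>
      subst h0
      exact h
    | succ i => exact hg i (by omega)

/-- Two sequences, the second of which starts where the first one is at the index `N`, can be
concatenated. -/
theorem exists_splice {α : Type*} (f g : ℕ → α) (N : ℕ) (h : g 0 = f N) :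
    ∃ s : ℕ → α, (∀ i ≤ N, s i = f i) ∧ ∀ j, s (N + j) = g j := by
  refine ⟨fun i => if i ≤ N then f i else g (i - N), fun i hi => if_pos hi, fun j => ?_⟩
  dsimp only
  split_ifs with hj
  · obtain rfl : j = 0 := by omega
    exact h.symm
  · rw [Nat.add_sub_cancel_left]

theorem splice_rel {α : Type*} {r : α → α → Prop} {f g s : ℕ → α} {n N j : ℕ}
    (hf : ∀ i, n ≤ i → i < N → r (f i) (f (i + 1))) (hg : ∀ i < j, r (g i) (g (i + 1)))
    (hsf : ∀ i ≤ N, s i = f i) (hsg : ∀ j, s (N + j) = g j) (i : ℕ) (hn : n ≤ i)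
    (hi : i < N + j) : r (s i) (s (i + 1)) := by
  rcases Nat.lt_or_ge i N with h | h
  · rw [hsf i h.le, hsf (i + 1) h]
    exact hf i hn h
  · obtain ⟨i, rfl⟩ := Nat.exists_eq_add_of_le h
    rw [hsg i, add_assoc, hsg (i + 1)]
    exact hg i (by omega)

/-! ### The graph of models: base clauses, edges, clause types and colors -/

namespace TemporalProblem

variable {L : FirstOrder.Language.{0, 0}} (P : TemporalProblem L) (K : Set L.Constants)

/-- The ground step clauses and the e-derived step clauses that mention only constants of `K`. -/
def baseClauses : Set (L.Sentence × L.Sentence) :=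
  (fun T : Finset (StepClause L 1) =>
      ((∃' BoundedFormula.iInf fun s : T => s.1.lhs.atVar : L.Sentence),
        (∃' BoundedFormula.iInf fun s : T => s.1.rhs.atVar : L.Sentence))) ''
      {T | (T : Set (StepClause L 1)) ⊆ P.step} ∪
    (fun p : StepClause L 1 × L.Constants => (p.1.lhs.atConst p.2, p.1.rhs.atConst p.2)) ''
      (P.step ×ˢ K) ∪
    (fun s : StepClause L 0 => (s.lhs.prop, s.rhs.prop)) '' P.groundStep

variable {P K}

theorem baseClauses_finite (hs : P.step.Finite) (hg : P.groundStep.Finite) (hK : K.Finite) :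
    (P.baseClauses K).Finite := by
  refine ((Set.Finite.image _ ?_).union ((hs.prod hK).image _)).union (hg.image _)
  exact hs.finite_subsets.preimage Finset.coe_injective.injOn

theorem eDerived_or_ground_of_mem_baseClauses {U : Set L.Sentence}
    (hK : K ⊆ (P.withUniv U).consts) {c : L.Sentence × L.Sentence} (hc : c ∈ P.baseClauses K) :
    (P.withUniv U).EDerived c.1 c.2 ∨
      ∃ s ∈ (P.withUniv U).groundStep, c.1 = s.lhs.prop ∧ c.2 = s.rhs.prop := by
  rcases hc with (⟨T, hT, rfl⟩ | ⟨⟨s, c⟩, ⟨hs, hc⟩, rfl⟩) | ⟨s, hs, rfl⟩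
  · exact .inl (.ex T fun s hs => hT hs)
  · exact .inl (EDerived.const (P := P.withUniv U) s hs c (hK hc))
  · exact .inr ⟨s, hs, rfl, rfl⟩

/-- The conjunction of the left-hand sides of a finite set of clauses. -/
noncomputable def lhsConj (T : Finset (L.Sentence × L.Sentence)) : L.Sentence :=
  BoundedFormula.iInf fun c : T => c.1.1

/-- The conjunction of the right-hand sides of a finite set of clauses. -/
noncomputable def rhsConj (T : Finset (L.Sentence × L.Sentence)) : L.Sentence :=
  BoundedFormula.iInf fun c : T => c.1.2

theorem realize_lhsConj {M : Type*} [L.Structure M] {T : Finset (L.Sentence × L.Sentence)} :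
    M ⊨ lhsConj T ↔ ∀ c ∈ T, M ⊨ c.1 := by
  rw [lhsConj, realize_sentence_iInf, Subtype.forall]

theorem realize_rhsConj {M : Type*} [L.Structure M] {T : Finset (L.Sentence × L.Sentence)} :
    M ⊨ rhsConj T ↔ ∀ c ∈ T, M ⊨ c.2 := by
  rw [rhsConj, realize_sentence_iInf, Subtype.forall]

theorem merged_conj {U : Set L.Sentence} (hK : K ⊆ (P.withUniv U).consts)
    {T : Finset (L.Sentence × L.Sentence)} (hT : ∀ c ∈ T, c ∈ P.baseClauses K) :
    (P.withUniv U).Merged (lhsConj T) (rhsConj T) :=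
  ⟨T, fun c hc => eDerived_or_ground_of_mem_baseClauses hK (hT c hc), rfl, rfl⟩

variable (P K)

/-- The structure `N` satisfies what the base clauses demand of the successor of `M`. -/
def Edge (M N : Type*) [L.Structure M] [L.Structure N] : Prop :=
  ∀ c ∈ P.baseClauses K, M ⊨ c.1 → N ⊨ c.2

open Classical in
/-- The base clauses whose left-hand side is true in `M`. -/
noncomputable def clauseType (hB : (P.baseClauses K).Finite) (M : Type*) [L.Structure M] :
    Finset (L.Sentence × L.Sentence) :=
  hB.toFinset.filter fun c => M ⊨ c.1

open Classical in
/-- The non-ground step clauses whose left-hand side is true of `d`. -/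
noncomputable def color (hS : P.step.Finite) {M : Type*} [L.Structure M] (d : M) :
    Finset (StepClause L 1) :=
  hS.toFinset.filter fun s => s.lhs.Holds fun _ => d

variable {P K}

section

variable {hB : (P.baseClauses K).Finite} {M N : Type*} [L.Structure M] [L.Structure N]

theorem mem_clauseType {c : L.Sentence × L.Sentence} :
    c ∈ P.clauseType K hB M ↔ c ∈ P.baseClauses K ∧ M ⊨ c.1 := by
  simp [clauseType]

theorem realize_lhsConj_clauseType : M ⊨ lhsConj (P.clauseType K hB M) :=
  realize_lhsConj.2 fun _ hc => (mem_clauseType.1 hc).2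

theorem realize_rhsConj_clauseType : N ⊨ rhsConj (P.clauseType K hB M) ↔ P.Edge K M N := by
  simp only [realize_rhsConj, mem_clauseType, Edge, and_imp]

theorem mem_color {hS : P.step.Finite} {s : StepClause L 1} {d : M} :
    s ∈ P.color hS d ↔ s ∈ P.step ∧ s.lhs.Holds fun _ => d := by
  simp [color]

theorem forall_mem_color {hS : P.step.Finite} {d : M} {d' : N} :
    (∀ s ∈ P.color hS d, s.rhs.Holds fun _ => d') ↔ P.StepRel d d' := by
  simp only [mem_color, StepRel, and_imp]

/-- As far as successors are concerned, elements fall into finitely many classes, even in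
uncountable models. -/
theorem stepRel_congr {M' : Type*} [L.Structure M'] {hS : P.step.Finite} {d : M} {d₁ : M'}
    (h : P.color hS d = P.color hS d₁) {d' : N} : P.StepRel d d' ↔ P.StepRel d₁ d' := by
  rw [← forall_mem_color (hS := hS), h, forall_mem_color]

/-- The existential e-derived clause for the whole color of `d` gives one witness for all triggered
step clauses at once. -/
theorem Edge.exists_stepRel (hS : P.step.Finite) (h : P.Edge K M N) (d : M) :
    ∃ d' : N, P.StepRel d d' := by
  have := h _ (.inl (.inl ⟨P.color hS d, fun s hs => (mem_color.1 hs).1, rfl⟩))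
    ((realize_ex_iInf_atVar fun s => s.lhs).2 ⟨d, fun s hs => (mem_color.1 hs).2⟩)
  obtain ⟨d', hd'⟩ := (realize_ex_iInf_atVar fun s => s.rhs).1 this
  exact ⟨d', forall_mem_color.1 hd'⟩

theorem Edge.stepRel_const (h : P.Edge K M N) {c : L.Constants} (hc : c ∈ K) :
    P.StepRel (c : M) (c : N) := by
  intro s hs hl
  have := h _ (.inl (.inr ⟨(s, c), ⟨hs, hc⟩, rfl⟩)) ((Literal.realize_atConst _ _).2 hl)
  exact (Literal.realize_atConst _ _).1 this

theorem Edge.groundStep (h : P.Edge K M N) {s : StepClause L 0} (hs : s ∈ P.groundStep)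
    (hl : M ⊨ s.lhs.prop) : N ⊨ s.rhs.prop :=
  h _ (.inr ⟨s, hs, rfl⟩) hl

end

/-! ### Saturation and the reachability of eventualities -/

/-- The conclusions of the rules do not exclude the clause type of any model of `U`. -/
def Saturated (P : TemporalProblem L) (K : Set L.Constants) (hB : (P.baseClauses K).Finite)
    (U : L.Theory) : Prop :=
  ∀ φ, (P.withUniv U).Infers φ → ∀ M : Theory.ModelType.{0, 0, 0} U,
    ∃ N : Theory.ModelType.{0, 0, 0} U, N ⊨ φ ∧ P.clauseType K hB N = P.clauseType K hB M

section Saturated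

variable {hB : (P.baseClauses K).Finite} {U : L.Theory}

/-- Without a successor, the merger of all clauses triggered in `M` has a right-hand side
inconsistent with `U`. Step resolution then infers a sentence false in every model of the type of
`M`, against saturation. -/
theorem Saturated.exists_edge (hU : P.Saturated K hB U) (hK : K ⊆ (P.withUniv U).consts)
    (M : Theory.ModelType.{0, 0, 0} U) : ∃ N : Theory.ModelType.{0, 0, 0} U, P.Edge K M N := by
  by_contra hno
  have hinf := Infers.stepResolution (P := P.withUniv U) _ _
    (merged_conj hK (T := P.clauseType K hB M) fun c hc => (mem_clauseType.1 hc).1) (by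
      rintro ⟨N⟩
      obtain ⟨h1, h2⟩ := model_union_singleton.1 N.is_model
      exact hno ⟨@Theory.ModelType.of L U N _ h1 _, realize_rhsConj_clauseType.1 h2⟩)
  obtain ⟨N, hN, hNM⟩ := hU _ hinf M
  exact (Sentence.realize_not _).1 hN (hNM ▸ realize_lhsConj_clauseType)

/-- Badness, the impossibility of reaching `l`, is inherited by successors, so the clause types of
the bad models form a loop for ground eventuality resolution. Its conclusion would exclude all these
types. -/
theorem Saturated.exists_path_groundEv (hU : P.Saturated K hB U)
    (hK : K ⊆ (P.withUniv U).consts) {l : Literal L 0} (hl : l ∈ P.groundEv)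
    (M : Theory.ModelType.{0, 0, 0} U) :
    ∃ N : Theory.ModelType.{0, 0, 0} U,
      Relation.TransGen (fun M N : Theory.ModelType.{0, 0, 0} U => P.Edge K M N) M N ∧
        N ⊨ l.prop := by
  classical
  let Bad : Theory.ModelType.{0, 0, 0} U → Prop := fun M =>
    ¬ ∃ N : Theory.ModelType.{0, 0, 0} U,
      Relation.TransGen (fun M N : Theory.ModelType.{0, 0, 0} U => P.Edge K M N) M N ∧ N ⊨ l.prop
  by_contra hM
  have bad_next : ∀ M N : Theory.ModelType.{0, 0, 0} U, Bad M → P.Edge K M N →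
      Bad N ∧ ¬ N ⊨ l.prop := fun M N hM h =>
    ⟨fun ⟨N', hN', h'⟩ => hM ⟨N', .head h hN', h'⟩, fun h' => hM ⟨N, .single h, h'⟩⟩
  let S : Finset (Finset (L.Sentence × L.Sentence)) :=
    hB.toFinset.powerset.filter fun t =>
      ∃ M : Theory.ModelType.{0, 0, 0} U, Bad M ∧ P.clauseType K hB M = t
  have hS : ∀ M : Theory.ModelType.{0, 0, 0} U, Bad M → P.clauseType K hB M ∈ S := fun M hM =>
    Finset.mem_filter.2 ⟨Finset.mem_powerset.2 (Finset.filter_subset _ _), M, hM, rfl⟩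
  let e := S.equivFin
  let t : Fin S.card → Finset (L.Sentence × L.Sentence) := fun i => (e.symm i).1
  have ht : ∀ i, ∃ M : Theory.ModelType.{0, 0, 0} U, Bad M ∧ P.clauseType K hB M = t i :=
    fun i => (Finset.mem_filter.1 (e.symm i).2).2
  have ht' : ∀ M : Theory.ModelType.{0, 0, 0} U, Bad M → ∃ i, t i = P.clauseType K hB M :=
    fun M hM => ⟨e ⟨_, hS M hM⟩, by simp [t]⟩
  -- A model of the `i`-th right-hand side is a successor of any bad model representing the type `t
  -- i`; hence it is bad itself and refutes `l`.
  have next : ∀ (i : Fin S.card) (N : Theory.ModelType.{0, 0, 0} (U ∪ {rhsConj (t i)})),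
      (∃ i, N ⊨ lhsConj (t i)) ∧ ¬ N ⊨ l.prop := by
    intro i N
    obtain ⟨M, hM, hMt⟩ := ht i
    obtain ⟨h1, h2⟩ := model_union_singleton.1 N.is_model
    have h2 : N ⊨ rhsConj (P.clauseType K hB M) := by rwa [hMt]
    obtain ⟨hN, hNl⟩ := bad_next M ⟨N⟩ hM (realize_rhsConj_clauseType.1 h2)
    obtain ⟨j, hj⟩ := ht' ⟨N⟩ hN
    exact ⟨⟨j, hj ▸ realize_lhsConj_clauseType⟩, hNl⟩
  have hinf := Infers.groundEventualityResolution (P := P.withUniv U) S.card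
    (Finset.card_pos.2 ⟨_, hS M hM⟩) (fun i => lhsConj (t i)) (fun i => rhsConj (t i))
    (fun i => merged_conj hK fun c hc => by
      obtain ⟨M, -, hM⟩ := ht i
      rw [← hM] at hc
      exact (mem_clauseType.1 hc).1) l hl
    (fun i => Theory.models_sentence_iff.2 fun N => (Sentence.realize_not _).2 (next i N).2)
    (fun i => Theory.models_sentence_iff.2 fun N => (realize_sentence_iSup _).2 (next i N).1)
  obtain ⟨N, hN, hNM⟩ := hU _ hinf M
  obtain ⟨i, hi⟩ := ht' M hM
  refine (Sentence.realize_not _).1 ((realize_sentence_iInf _).1 hN i) ?_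
  rw [hi, ← hNM]
  exact realize_lhsConj_clauseType

/-- One step of an element of a model into an element of a successor model. -/
def PointEdge (P : TemporalProblem L) (K : Set L.Constants) {U : L.Theory}
    (x y : Σ M : Theory.ModelType.{0, 0, 0} U, M) : Prop :=
  P.Edge K x.1 y.1 ∧ P.StepRel x.2 y.2

/-- The same argument for pointed models: the loop is indexed by the pairs of a clause type and a
color realised by bad points. -/
theorem Saturated.exists_path_ev (hU : P.Saturated K hB U) (hK : K ⊆ (P.withUniv U).consts)
    (hS : P.step.Finite) {l : Literal L 1} (hl : l ∈ P.ev)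
    (x : Σ M : Theory.ModelType.{0, 0, 0} U, M) :
    ∃ y, Relation.TransGen (P.PointEdge K (U := U)) x y ∧ l.Holds fun _ => y.2 := by
  classical
  let Pt := Σ M : Theory.ModelType.{0, 0, 0} U, M
  let Bad : Pt → Prop := fun x =>
    ¬ ∃ y, Relation.TransGen (P.PointEdge K (U := U)) x y ∧ l.Holds fun _ => y.2
  by_contra hx
  have bad_next : ∀ x y, Bad x → P.PointEdge K x y → Bad y ∧ ¬ l.Holds fun _ => y.2 :=
    fun x y hx h => ⟨fun ⟨z, hz, h'⟩ => hx ⟨z, .head h hz, h'⟩, fun h' => hx ⟨y, .single h, h'⟩⟩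
  let ptType : Pt → Finset (L.Sentence × L.Sentence) × Finset (StepClause L 1) := fun x =>
    (P.clauseType K hB x.1, P.color hS x.2)
  let S := (hB.toFinset.powerset ×ˢ hS.toFinset.powerset).filter fun t => ∃ x, Bad x ∧ ptType x = t
  have mem_S : ∀ x, Bad x → ptType x ∈ S := fun x hx =>
    Finset.mem_filter.2 ⟨Finset.mem_product.2 ⟨Finset.mem_powerset.2 (Finset.filter_subset _ _),
      Finset.mem_powerset.2 (Finset.filter_subset _ _)⟩, x, hx, rfl⟩
  let e := S.equivFin
  let t : Fin S.card → Finset (L.Sentence × L.Sentence) × Finset (StepClause L 1) :=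
    fun i => (e.symm i).1
  have ht : ∀ i, ∃ x, Bad x ∧ ptType x = t i := fun i => (Finset.mem_filter.1 (e.symm i).2).2
  have ht' : ∀ x, Bad x → ∃ i, t i = ptType x := fun x hx => ⟨e ⟨_, mem_S x hx⟩, by simp [t]⟩
  let A : Fin S.card → L.BoundedFormula Empty 1 := fun i =>
    BoundedFormula.iInf fun s : (t i).2 => s.1.lhs.atVar
  let B : Fin S.card → L.BoundedFormula Empty 1 := fun i =>
    BoundedFormula.iInf fun s : (t i).2 => s.1.rhs.atVar
  have next : ∀ (i : Fin S.card) (N : Theory.ModelType.{0, 0, 0} U) (v : Empty → N)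
      (xs : Fin 1 → N), N ⊨ rhsConj (t i).1 → (B i).Realize v xs →
      (∃ j, N ⊨ lhsConj (t j).1 ∧ (A j).Realize v xs) ∧ ¬ l.Holds fun _ => xs 0 := by
    intro i N v xs h1 h2
    obtain ⟨x, hx, hxt⟩ := ht i
    rw [realize_iInf_lhs (t i).2 fun s => s.rhs] at h2
    rw [← hxt] at h1 h2
    obtain ⟨hN, hNl⟩ := bad_next x ⟨N, xs 0⟩ hx
      ⟨realize_rhsConj_clauseType.1 h1, forall_mem_color.1 h2⟩
    obtain ⟨j, hj⟩ := ht' _ hN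
    refine ⟨⟨j, ?_, ?_⟩, hNl⟩
    · rw [hj]
      exact realize_lhsConj_clauseType
    · rw [realize_iInf_lhs (t j).2 fun s => s.lhs, hj]
      exact fun s hs => (mem_color.1 hs).2
  have hinf := Infers.eventualityResolution (P := P.withUniv U) S.card
    (Finset.card_pos.2 ⟨_, mem_S x hx⟩) (fun i => lhsConj (t i).1) (fun i => rhsConj (t i).1) A B
    (fun i => by
      obtain ⟨x, -, hx⟩ := ht i
      exact ⟨merged_conj hK fun c hc => by
          rw [← hx] at hc
          exact (mem_clauseType.1 hc).1,
        (t i).2, fun s hs => by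
          rw [← hx] at hs
          exact (mem_color.1 hs).1, rfl, rfl⟩) l hl
    (fun i N v xs => by
      simp only [BoundedFormula.realize_imp, BoundedFormula.realize_inf, realize_weaken,
        BoundedFormula.realize_not, Literal.realize_atVar]
      exact fun h => (next i N v xs h.1 h.2).2)
    (fun i N v xs => by
      simp only [BoundedFormula.realize_imp, BoundedFormula.realize_inf, realize_weaken,
        BoundedFormula.realize_iSup]
      exact fun h => (next i N v xs h.1 h.2).1)
  obtain ⟨N, hN, hNM⟩ := hU _ hinf x.1
  rw [realize_all_not_or] at hN
  -- Saturation preserves only the clause type, not the point. But the type records that some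
  -- element satisfies all left-hand sides in the color of `x.2`, and such an element of `N` already
  -- violates the conclusion.
  have mem : ((∃' BoundedFormula.iInf fun s : P.color hS x.2 => s.1.lhs.atVar : L.Sentence),
      (∃' BoundedFormula.iInf fun s : P.color hS x.2 => s.1.rhs.atVar : L.Sentence)) ∈
      P.clauseType K hB x.1 := mem_clauseType.2
    ⟨.inl (.inl ⟨P.color hS x.2, fun s hs => (mem_color.1 hs).1, rfl⟩),
      (realize_ex_iInf_atVar fun s => s.lhs).2 ⟨x.2, fun s hs => (mem_color.1 hs).2⟩⟩
  rw [← hNM, mem_clauseType] at mem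
  obtain ⟨d, hd⟩ := (realize_ex_iInf_atVar fun s => s.lhs).1 mem.2
  obtain ⟨i, hi⟩ := ht' x hx
  refine hN d i ?_ ?_
  · rw [hi, ← show P.clauseType K hB N = (ptType x).1 from hNM]
    exact realize_lhsConj_clauseType
  · rw [realize_iInf_lhs (t i).2 fun s => s.lhs, hi]
    exact hd

/-- Runs are sequences of pairs of a model and an element, not dependent functions over `f`, because
`f` will be replaced by spliced sequences that agree with it only up to an index. -/
theorem exists_run_of_path (hS : P.step.Finite) {f : ℕ → Theory.ModelType.{0, 0, 0} U} {n N : ℕ}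
    (hnN : n ≤ N) (hf : ∀ j, n ≤ j → j < N → P.Edge K (f j) (f (j + 1)))
    (y : Σ M : Theory.ModelType.{0, 0, 0} U, M) (hy : y.1 = f n) :
    ∃ x : ℕ → Σ M : Theory.ModelType.{0, 0, 0} U, M, x n = y ∧
      (∀ j, n ≤ j → j ≤ N → (x j).1 = f j) ∧
      ∀ j, n ≤ j → j < N → P.StepRel (x j).2 (x (j + 1)).2 := by
  induction N, hnN using Nat.le_induction with
  | base =>
    refine ⟨fun _ => y, rfl, fun j h h' => ?_, fun j h h' => absurd h' (by omega)⟩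
    rw [hy, le_antisymm h h']
  | succ N hN ih =>
    obtain ⟨x, h0, h1, h2⟩ := ih fun j h h' => hf j h (by omega)
    have hE := hf N hN (Nat.lt_succ_self N)
    rw [← h1 N hN le_rfl] at hE
    obtain ⟨d, hd⟩ := hE.exists_stepRel hS (x N).2
    have hx : ∀ j ≤ N, Function.update x (N + 1) ⟨f (N + 1), d⟩ j = x j := fun j hj =>
      Function.update_of_ne (by omega) _ _
    refine ⟨Function.update x (N + 1) ⟨f (N + 1), d⟩, (hx n hN).trans h0, fun j h h' => ?_,
      fun j h h' => ?_⟩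
    · rcases Nat.lt_or_ge N j with hj | hj
      · obtain rfl : j = N + 1 := by omega
        rw [Function.update_self]
      · rw [hx j hj, h1 j h hj]
    · rw [hx j (by omega)]
      rcases Nat.lt_or_ge j N with hj | hj
      · rw [hx (j + 1) hj]
        exact h2 j h hj
      · obtain rfl : j = N := by omega
        rw [Function.update_self]
        exact hd

/-- The element `y` of the model at the moment `n` has a run up to the moment `m`, at which the
literal `l` is true. -/
def ReachesAt (P : TemporalProblem L) {U : L.Theory} (f : ℕ → Theory.ModelType.{0, 0, 0} U) (n : ℕ)
    (l : Literal L 1) (y : Σ M : Theory.ModelType.{0, 0, 0} U, M) (m : ℕ) : Prop :=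
  ∃ x : ℕ → Σ M : Theory.ModelType.{0, 0, 0} U, M, x n = y ∧
    (∀ j, n ≤ j → j ≤ m → (x j).1 = f j) ∧
    (∀ j, n ≤ j → j < m → P.StepRel (x j).2 (x (j + 1)).2) ∧ l.Holds fun _ => (x m).2

theorem Saturated.exists_sequence_reachesAt (hU : P.Saturated K hB U)
    (hK : K ⊆ (P.withUniv U).consts) (hS : P.step.Finite) (hgev : P.groundEv.Countable)
    (hev : P.ev.Countable) (M₀ : Theory.ModelType.{0, 0, 0} U) :
    ∃ f : ℕ → Theory.ModelType.{0, 0, 0} U, f 0 = M₀ ∧ (∀ n, P.Edge K (f n) (f (n + 1))) ∧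
      (∀ l ∈ P.groundEv, ∀ n, ∃ m, n ≤ m ∧ f m ⊨ l.prop) ∧
      ∀ l ∈ P.ev, ∀ n y, y.1 = f n → ∃ m, n ≤ m ∧ P.ReachesAt f n l y m := by
  classical
  have := hgev.to_subtype
  have := hev.to_subtype
  let Model := Theory.ModelType.{0, 0, 0} U
  let Pt := Σ M : Model, M
  have : Nonempty Model := ⟨M₀⟩
  -- Models may have uncountably many elements, so requests are indexed by colors instead: this
  -- keeps them countable.
  let I := (P.groundEv × ℕ) ⊕ (P.ev × ℕ × hS.toFinset.powerset)
  let Q : I → (ℕ → Model) → ℕ → Prop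
    | .inl (l, n), f, N => ∃ m, n ≤ m ∧ m ≤ N ∧ f m ⊨ l.1.prop
    | .inr (l, n, T), f, N => n ≤ N ∧ ∀ y : Pt, y.1 = f n → P.color hS y.2 = T.1 →
        ∃ m, n ≤ m ∧ m ≤ N ∧ P.ReachesAt f n l.1 y m
  let B : I → ℕ
    | .inl (_, n) => n
    | .inr (_, n, _) => n
  have hloc : ∀ i (f g : ℕ → Model) N, (∀ n ≤ N, f n = g n) → Q i f N → Q i g N := by
    rintro (⟨l, n⟩ | ⟨l, n, T⟩) f g N h
    · rintro ⟨m, h1, h2, h3⟩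
      exact ⟨m, h1, h2, h m h2 ▸ h3⟩
    · rintro ⟨hn, hQ⟩
      refine ⟨hn, fun y hy hyT => ?_⟩
      obtain ⟨m, h1, h2, x, hx1, hx2, hx3⟩ := hQ y (hy.trans (h n hn).symm) hyT
      exact ⟨m, h1, h2, x, hx1, fun j hj hj' => (hx2 j hj hj').trans (h j (hj'.trans h2)), hx3⟩
  have hext : ∀ i (f : ℕ → Model) N, B i ≤ N → 0 ≤ N →
      (∀ n, 0 ≤ n → n < N → P.Edge K (f n) (f (n + 1))) →
      ∃ (g : ℕ → Model) (N' : ℕ), N ≤ N' ∧ (∀ n ≤ N, g n = f n) ∧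
        (∀ n, 0 ≤ n → n < N' → P.Edge K (g n) (g (n + 1))) ∧ Q i g N' := by
    rintro (⟨l, n⟩ | ⟨l, n, T⟩) f N hn - hf
    · obtain ⟨M, hM, hMl⟩ := hU.exists_path_groundEv hK l.2 (f N)
      obtain ⟨g, j, -, g0, gj, hg⟩ := exists_seq_of_transGen hM
      obtain ⟨s, hsf, hsg⟩ := exists_splice f g N g0
      refine ⟨s, N + j, by omega, hsf,
        splice_rel (r := fun M N : Model => P.Edge K M N) hf hg hsf hsg, N + j, hn.trans (by omega), le_rfl, ?_⟩
      rw [hsg, gj]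
      exact hMl
    · by_cases hy₀ : ∃ y : Pt, y.1 = f n ∧ P.color hS y.2 = T.1
      · obtain ⟨y₀, hy₀, hyT₀⟩ := hy₀
        have hn : n ≤ N := hn
        -- One representative of the color is carried along the models already chosen up to `N`, and
        -- then steered to the eventuality, which determines the new models.
        obtain ⟨x, x0, hx, hxs⟩ := exists_run_of_path hS hn
          (fun j _ => hf j (Nat.zero_le _)) y₀ hy₀
        obtain ⟨z, hz, hzl⟩ := hU.exists_path_ev hK hS l.2 (x N)
        obtain ⟨g, j, j0, g0, gj, hg⟩ := exists_seq_of_transGen hz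
        obtain ⟨s, hsf, hsg⟩ := exists_splice f (fun i => (g i).1) N (by
          rw [g0, hx N hn le_rfl])
        obtain ⟨t, htx, htg⟩ := exists_splice x g N g0
        have hts : ∀ i, n ≤ i → (t i).1 = s i := by
          intro i hi
          rcases le_total i N with h | h
          · rw [htx i h, hsf i h, hx i hi h]
          · obtain ⟨i, rfl⟩ := Nat.exists_eq_add_of_le h
            rw [htg, hsg]
        have ht := splice_rel (r := fun x y : Pt => P.StepRel x.2 y.2) hxs
          (fun i hi => (hg i hi).2) htx htg
        -- Any other element of the same color may replace the representative at `n`, as it has the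
        -- same possible successors.
        refine ⟨s, N + j, by omega, hsf,
          splice_rel (r := fun M N : Model => P.Edge K M N) hf (fun i hi => (hg i hi).1) hsf hsg,
          by omega, fun y hy hyT => ⟨N + j, by omega, le_rfl,
            Function.update t n y, Function.update_self .., fun i hi hi' => ?_,
            fun i hi hi' => ?_, ?_⟩⟩
        · by_cases h : i = n
          · rw [h, Function.update_self, hy]
          · rw [Function.update_of_ne h, hts i hi]
        · rw [Function.update_of_ne (show i + 1 ≠ n by omega)]
          by_cases h : i = n
          · subst h
            rw [Function.update_self, stepRel_congr (hyT.trans hyT₀.symm), ← x0, ← htx i hn]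
            exact ht i le_rfl hi'
          · rw [Function.update_of_ne h]
            exact ht i hi hi'
        -- `0 < j` matters: if the goal were at the moment `n` itself, replacing the first element
        -- would lose the literal.
        · rw [Function.update_of_ne (by omega), htg, gj]
          exact hzl
      · exact ⟨f, N, le_rfl, fun _ _ => rfl, hf, hn, fun y hy hyT => absurd ⟨y, hy, hyT⟩ hy₀⟩
  obtain ⟨f, hf0, hf, hfQ⟩ := exists_generic_path (α := fun _ => Model) (k := 0)
    (R := fun _ M N => P.Edge K M N) (fun _ M => hU.exists_edge hK M) M₀ Q B hloc hext
  refine ⟨f, hf0, fun n => hf n (Nat.zero_le n), fun l hl n => ?_, fun l hl n y hy => ?_⟩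
  · obtain ⟨N, m, h1, -, h2⟩ := hfQ (.inl (⟨l, hl⟩, n))
    exact ⟨m, h1, h2⟩
  · obtain ⟨N, -, hN⟩ := hfQ (.inr (⟨l, hl⟩, n,
      ⟨P.color hS y.2, Finset.mem_powerset.2 (Finset.filter_subset _ _)⟩))
    obtain ⟨m, h1, -, h2⟩ := hN y hy rfl
    exact ⟨m, h1, h2⟩

theorem ReachesAt.exists_elements {f : ℕ → Theory.ModelType.{0, 0, 0} U} {n m : ℕ}
    {l : Literal L 1} {d : f n} (h : P.ReachesAt f n l ⟨f n, d⟩ m) (hnm : n ≤ m) :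
    ∃ r : ∀ j, f j, r n = d ∧ (∀ j, n ≤ j → j < m → P.StepRel (r j) (r (j + 1))) ∧
      l.Holds fun _ => r m := by
  classical
  obtain ⟨x, x0, hx, hs, hl⟩ := h
  have key : ∀ j, ∃ e : f j, n ≤ j → j ≤ m → x j = ⟨f j, e⟩ := by
    intro j
    by_cases h : n ≤ j ∧ j ≤ m
    · have := hx j h.1 h.2
      generalize x j = y at this
      obtain ⟨M, e⟩ := y
      obtain rfl : M = f j := this
      exact ⟨e, fun _ _ => rfl⟩
    · exact ⟨Classical.arbitrary _, fun h1 h2 => absurd ⟨h1, h2⟩ h⟩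
  choose r hr using key
  refine ⟨r, ?_, fun j h h' => ?_, ?_⟩
  · have := (hr n le_rfl hnm).symm.trans x0
    exact eq_of_heq (Sigma.mk.inj this).2
  · have := hs j h h'
    rwa [hr j h h'.le, hr (j + 1) (by omega) h'] at this
  · rwa [hr m hnm le_rfl] at hl

/-- The models are now fixed. From the end of any finite run each eventuality can still be reached,
so a generic run meets all of them infinitely often. -/
theorem exists_fairRun {f : ℕ → Theory.ModelType.{0, 0, 0} U} (hS : P.step.Finite)
    (hev : P.ev.Countable) (hE : ∀ n, P.Edge K (f n) (f (n + 1)))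
    (hf : ∀ l ∈ P.ev, ∀ n y, y.1 = f n → ∃ m, n ≤ m ∧ P.ReachesAt f n l y m) (k : ℕ) (d : f k) :
    ∃ r : ∀ n, f n, P.FairRun k r ∧ r k = d := by
  have := hev.to_subtype
  let Q : P.ev × ℕ → (∀ n, f n) → ℕ → Prop := fun i r N =>
    ∃ m, i.2 ≤ m ∧ m ≤ N ∧ i.1.1.Holds fun _ => r m
  have hloc : ∀ i (r r' : ∀ n, f n) N, (∀ n ≤ N, r n = r' n) → Q i r N → Q i r' N := by
    rintro i r r' N h ⟨m, h1, h2, h3⟩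
    exact ⟨m, h1, h2, h m h2 ▸ h3⟩
  have hext : ∀ i (r : ∀ n, f n) N, i.2 ≤ N → k ≤ N →
      (∀ n, k ≤ n → n < N → P.StepRel (r n) (r (n + 1))) →
      ∃ (r' : ∀ n, f n) (N' : ℕ), N ≤ N' ∧ (∀ n ≤ N, r' n = r n) ∧
        (∀ n, k ≤ n → n < N' → P.StepRel (r' n) (r' (n + 1))) ∧ Q i r' N' := by
    rintro ⟨l, n⟩ r N hn hk hr
    obtain ⟨m, hm, h⟩ := hf l.1 l.2 N ⟨f N, r N⟩ rfl
    obtain ⟨g, g0, hg, gl⟩ := h.exists_elements hm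
    have hgN : ∀ i, N ≤ i → (if i ≤ N then r i else g i) = g i := by
      intro i hi
      split_ifs with h
      · obtain rfl := le_antisymm h hi
        exact g0.symm
      · rfl
    refine ⟨fun i => if i ≤ N then r i else g i, m, hm, fun i hi => if_pos hi, fun i h1 h2 => ?_,
      m, le_trans hn hm, le_rfl, ?_⟩
    · dsimp only
      rcases Nat.lt_or_ge i N with h | h
      · rw [if_pos h.le, if_pos (Nat.succ_le_of_lt h)]
        exact hr i h1 h
      · rw [hgN i h, hgN (i + 1) (by omega)]
        exact hg i h h2
    · dsimp only
      rw [hgN m hm]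
      exact gl
  obtain ⟨r, h0, h1, h2⟩ := exists_generic_path (α := fun n => f n)
    (R := fun _ d d' => P.StepRel d d') (fun n d => (hE n).exists_stepRel hS d) d Q
    (fun i => i.2) hloc hext
  refine ⟨r, ⟨h1, fun l hl n => ?_⟩, h0⟩
  obtain ⟨N, m, h, -, h'⟩ := h2 (⟨l, hl⟩, n)
  exact ⟨m, h, h'⟩

end Saturated

end TemporalProblem

/-! ### Constants and change of language -/

section Constants

variable {L L' : FirstOrder.Language.{0, 0}}

theorem termConsts_finite {α : Type} (t : L.Term α) : (termConsts t).Finite := by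
  induction t with
  | var => exact Set.finite_empty
  | @func k f ts ih =>
    cases k with
    | zero => exact Set.finite_singleton _
    | succ k => exact Set.finite_iUnion ih

theorem formulaConsts_finite {α : Type} {n : ℕ} (φ : L.BoundedFormula α n) :
    (formulaConsts φ).Finite := by
  induction φ with
  | falsum => exact Set.finite_empty
  | equal t₁ t₂ => exact (termConsts_finite t₁).union (termConsts_finite t₂)
  | rel r ts => exact Set.finite_iUnion fun i => termConsts_finite (ts i)
  | imp φ ψ ih₁ ih₂ => exact ih₁.union ih₂
  | all φ ih => exact ih

theorem mem_termConsts_onTerm (g : L →ᴸ L') {α : Type} (t : L.Term α) {c : L.Constants}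
    (hc : c ∈ termConsts t) : (g.onFunction c : L'.Constants) ∈ termConsts (g.onTerm t) := by
  induction t with
  | var => exact hc.elim
  | @func k f ts ih =>
    cases k with
    | zero =>
      obtain rfl : c = f := hc
      exact Set.mem_singleton _
    | succ k =>
      obtain ⟨i, hi⟩ := Set.mem_iUnion.1 hc
      exact Set.mem_iUnion.2 ⟨i, ih i hi⟩

theorem mem_formulaConsts_onBoundedFormula (g : L →ᴸ L') {α : Type} {n : ℕ}
    (φ : L.BoundedFormula α n) {c : L.Constants} (hc : c ∈ formulaConsts φ) :
    (g.onFunction c : L'.Constants) ∈ formulaConsts (g.onBoundedFormula φ) := by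
  induction φ with
  | falsum => exact hc.elim
  | equal t₁ t₂ => exact hc.imp (mem_termConsts_onTerm g t₁) (mem_termConsts_onTerm g t₂)
  | rel r ts =>
    obtain ⟨i, hi⟩ := Set.mem_iUnion.1 hc
    exact Set.mem_iUnion.2 ⟨i, mem_termConsts_onTerm g (ts i) hi⟩
  | imp φ ψ ih₁ ih₂ => exact hc.imp ih₁ ih₂
  | all φ ih => exact ih hc

theorem Literal.map_holds (g : L →ᴸ L') {M : Type*} [L.Structure M] [L'.Structure M]
    [g.IsExpansionOn M] {k : ℕ} (l : Literal L k) (xs : Fin k → M) :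
    (l.map g).Holds xs ↔ l.Holds xs := by
  simp only [Literal.Holds, Literal.map, LHom.map_onRelation]

theorem Literal.realize_map_prop (g : L →ᴸ L') {M : Type*} [L.Structure M] [L'.Structure M]
    [g.IsExpansionOn M] (l : Literal L 0) : M ⊨ (l.map g).prop ↔ M ⊨ l.prop := by
  rw [Literal.realize_prop, Literal.realize_prop, Literal.map_holds]

end Constants

/-! ### Completeness -/

namespace TemporalProblem

variable {L : FirstOrder.Language.{0, 0}} {P : TemporalProblem L}

theorem consts_finite (hP : P.IsDSNF) : P.consts.Finite :=
  (hP.univ_finite.union hP.init_finite).biUnion fun φ _ => formulaConsts_finite φ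

theorem consts_subset_withUniv {U : Set L.Sentence} (h : P.univ ⊆ U) :
    P.consts ⊆ (P.withUniv U).consts :=
  Set.biUnion_subset_biUnion_left (Set.union_subset_union_left _ h)

theorem image_consts_subset_flooded :
    (fun c => ((floodIncl L).onFunction c : (floodLanguage L).Constants)) '' P.consts ⊆
      P.flooded.consts := by
  rintro _ ⟨c, hc, rfl⟩
  obtain ⟨φ, hφ, hc⟩ := Set.mem_iUnion₂.1 hc
  refine Set.mem_biUnion (x := (floodIncl L).onSentence φ) ?_
    (mem_formulaConsts_onBoundedFormula _ φ hc)
  rcases hφ with hφ | hφ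
  · exact .inl (.inl ⟨φ, hφ, rfl⟩)
  · exact .inr ⟨φ, hφ, rfl⟩

/-- The universal part `U'` arises from `U` by adding the conclusion of a rule. -/
def Derives (P : TemporalProblem L) (U U' : Set L.Sentence) : Prop :=
  ∃ φ, (P.withUniv U).Infers φ ∧ U' = insert φ U

theorem hasSuccessfulDerivation_of_terminates {U : Set L.Sentence}
    (h : Relation.ReflTransGen P.Derives P.univ U) (hU : (P.withUniv U).Terminates) :
    P.HasSuccessfulDerivation := by
  rcases Relation.reflTransGen_iff_eq_or_transGen.1 h with rfl | h
  · exact ⟨0, fun _ => P.univ, rfl, fun i hi => absurd hi (Nat.not_lt_zero i), hU⟩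
  · obtain ⟨g, n, -, h0, hn, hg⟩ := exists_seq_of_transGen h
    exact ⟨n, g, h0, hg, hn ▸ hU⟩

theorem univ_subset_of_derives {U : Set L.Sentence}
    (h : Relation.ReflTransGen P.Derives P.univ U) : P.univ ⊆ U := by
  induction h with
  | refl => exact subset_rfl
  | tail _ h ih =>
    obtain ⟨φ, -, rfl⟩ := h
    exact ih.trans (Set.subset_insert _ _)

/-- Adding a conclusion can only shrink the finite set of clause types realised by models. Where
their number is minimal, no conclusion removes a type. -/
theorem exists_saturated {K : Set L.Constants} (hB : (P.baseClauses K).Finite) :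
    ∃ U, Relation.ReflTransGen P.Derives P.univ U ∧ P.Saturated K hB U := by
  let types : L.Theory → Set (Finset (L.Sentence × L.Sentence)) := fun U =>
    Set.range fun M : Theory.ModelType.{0, 0, 0} U => P.clauseType K hB M
  have fin : ∀ U, (types U).Finite := fun U =>
    (Finset.finite_toSet hB.toFinset.powerset).subset (by
      rintro _ ⟨M, rfl⟩
      exact Finset.mem_coe.2 (Finset.mem_powerset.2 fun c hc =>
        hB.mem_toFinset.2 (mem_clauseType.1 hc).1))
  obtain ⟨U, hU, hmin⟩ := exists_minimalFor_of_wellFoundedLT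
    (Relation.ReflTransGen P.Derives P.univ) (fun U => (types U).ncard) ⟨P.univ, .refl⟩
  refine ⟨U, hU, fun φ hφ M => ?_⟩
  have model : ∀ N : Theory.ModelType.{0, 0, 0} (insert φ U : L.Theory), N ⊨ φ ∧ N ⊨ U :=
    fun N => model_insert.1 N.is_model
  have sub : types (insert φ U) ⊆ types U := by
    rintro _ ⟨N, rfl⟩
    exact ⟨@Theory.ModelType.of L U N _ (model N).2 _, rfl⟩
  have eq : types (insert φ U) = types U :=
    Set.eq_of_subset_of_ncard_le sub
      (hmin (hU.tail ⟨φ, hφ, rfl⟩) (Set.ncard_le_ncard sub (fin U))) (fin U)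
  obtain ⟨N, hN⟩ : P.clauseType K hB M ∈ types (insert φ U) := eq ▸ ⟨M, rfl⟩
  exact ⟨@Theory.ModelType.of L U N _ (model N).2 _, (model N).1, hN⟩

theorem satisfiable_of_not_hasSuccessfulDerivation [∀ n, IsEmpty (L.Functions (n + 1))]
    (hP : P.IsDSNF) (hno : ¬ P.flooded.HasSuccessfulDerivation) : P.Satisfiable.{w} := by
  -- Fixing the constants in advance makes the base clauses independent of the growing universal
  -- part.
  let K : Set (floodLanguage L).Constants := (fun c => (floodIncl L).onFunction c) '' P.consts
  have hS : P.flooded.step.Finite := hP.step_finite.image _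
  have hB : (P.flooded.baseClauses K).Finite :=
    baseClauses_finite hS (hP.groundStep_finite.image _) ((consts_finite hP).image _)
  have hgev : P.flooded.groundEv.Countable := by
    refine (hP.groundEv_finite.image _).countable.union (Set.Finite.countable ?_)
    refine ((hP.ev_finite.prod (consts_finite hP)).image fun p => floodLiteral p.1 p.2).subset ?_
    rintro _ ⟨l, hl, c, hc, rfl⟩
    exact ⟨(l, c), ⟨hl, hc⟩, rfl⟩
  have hev : P.flooded.ev.Countable := (hP.ev_finite.image _).countable
  obtain ⟨U, hU, hsat⟩ := exists_saturated hB
  have hPU := univ_subset_of_derives hU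
  have hK : K ⊆ (P.flooded.withUniv U).consts :=
    image_consts_subset_flooded.trans (consts_subset_withUniv hPU)
  -- Only the initial termination rule is used: saturation already makes every eventuality
  -- reachable.
  have hterm : Theory.IsSatisfiable (U ∪ P.flooded.init) := by
    by_contra h
    exact hno (hasSuccessfulDerivation_of_terminates hU (.initial h))
  obtain ⟨M₀⟩ := hterm
  obtain ⟨hM₀U, hM₀I⟩ := Theory.model_union_iff.1 M₀.is_model
  obtain ⟨f, hf0, hE, hfg, hfe⟩ := hsat.exists_sequence_reachesAt hK hS hgev hev
    (@Theory.ModelType.of _ U M₀ _ hM₀U _)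
  let _ : ∀ n, L.Structure (f n) := fun n => (floodIncl L).reduct (f n)
  have : ∀ n, (floodIncl L).IsExpansionOn (f n) := fun n =>
    LHom.isExpansionOn_reduct (floodIncl L) (f n)
  have realize : ∀ n, ∀ φ ∈ P.flooded.univ, f n ⊨ φ := fun n φ hφ =>
    (f n).is_model.realize_of_mem φ (hPU hφ)
  have run : ∀ k (r : ∀ n, f n), P.flooded.FairRun k r → P.FairRun k r := by
    refine fun k r hr => ⟨fun n hn s hs h => ?_, fun l hl n => ?_⟩
    · rw [← Literal.map_holds (floodIncl L)] at h ⊢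
      exact hr.1 n hn _ ⟨s, hs, rfl⟩ h
    · obtain ⟨m, hm, h⟩ := hr.2 _ ⟨l, hl, rfl⟩ n
      exact ⟨m, hm, (Literal.map_holds (floodIncl L) l _).1 h⟩
  refine satisfiable_of_fairRuns hP (fun n => f n) (fun φ hφ => ?_) (fun n φ hφ => ?_)
    (fun s hs n h => ?_) (fun l hl n => ?_) (fun n d => ?_) (fun c hc => ⟨fun n _ s hs h => ?_,
      fun l hl n => ?_⟩)
  · rw [← LHom.realize_onSentence _ (floodIncl L), hf0]
    exact hM₀I.realize_of_mem _ ⟨φ, hφ, rfl⟩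
  · rw [← LHom.realize_onSentence _ (floodIncl L)]
    exact realize n _ (.inl ⟨φ, hφ, rfl⟩)
  · rw [← Literal.realize_map_prop (floodIncl L)] at h ⊢
    exact (hE n).groundStep ⟨s, hs, rfl⟩ h
  · obtain ⟨m, hm, h⟩ := hfg _ (.inl ⟨l, hl, rfl⟩) n
    exact ⟨m, hm, (Literal.realize_map_prop (floodIncl L) l).1 h⟩
  · obtain ⟨r, hr, hd⟩ := exists_fairRun hS hev hE hfe n d
    exact ⟨r, run n r hr, hd⟩
  · rw [← Literal.map_holds (floodIncl L)] at h ⊢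
    exact (hE n).stepRel_const ⟨c, hc, rfl⟩ _ ⟨s, hs, rfl⟩ h
  -- Flooding enters here: the new proposition recurs as a ground eventuality, and its universal
  -- clause turns it into the literal at `c`.
  · obtain ⟨m, hm, h⟩ := hfg _ (.inr ⟨l, hl, c, hc, rfl⟩) n
    refine ⟨m, hm, (Literal.realize_atConst l c).1 ?_⟩
    rw [← LHom.realize_onSentence _ (floodIncl L)]
    exact (Sentence.realize_imp _).1 (realize m _ (.inr ⟨l, hl, c, hc, rfl⟩)) h

end TemporalProblem

end FOTL

theorem mainTheorem5 (L : FirstOrder.Language.{0, 0}) [∀ n, IsEmpty (L.Functions (n + 1))]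
    (P : FOTL.TemporalProblem L) (hP : P.IsDSNF) :
    -- the rules preserve satisfiability over expanding domains
    (∀ φ, P.Infers φ → P.Satisfiable.{w} → (P.withUniv (insert φ P.univ)).Satisfiable.{w}) ∧
    (P.Terminates → ¬ P.Satisfiable.{w}) ∧
    (P.HasSuccessfulDerivation → ¬ P.Satisfiable.{w}) ∧
    -- completeness
    (¬ P.Satisfiable.{w} → P.flooded.HasSuccessfulDerivation) :=
  ⟨fun _ h => h.satisfiable, fun h => h.not_satisfiable, fun h => h.not_satisfiable,
    fun h => by_contra fun h' =>
      h (FOTL.TemporalProblem.satisfiable_of_not_hasSuccessfulDerivation hP h')⟩
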